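/- Let $1/2 < c < 1$ and put $k = \min\left\{\frac{1-c}{2}, \frac{c}{3}\right\}$. Let $d = d(n)$ be a sequence of natural numbers with $d = \Theta(n^c)$ (in particular, $d$ may be $n^c$ rounded to a neighbouring integer), and let $v = v(n) = L(n)^2$ be a sequence of perfect squares with $v = o(n^k)$. For those $n$ for which $n\,d(n)$ is even, let $G$ be a uniformly random labelled simple $d$-regular graph on $n$ vertices. Then, as $n \to \infty$ through these $n$, with probability $1 - o(1)$ the graph $G$ contains the $L \times L$ square grid graph (the Cartesian product of two paths on $L$ vertices each, which has $v$ vertices) as an induced subgraph. -/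

import Mathlib

open Filter Topology Asymptotics

/-- The `L × L` square grid graph, on `L ^ 2` vertices: the box product of two paths with `L`
vertices each. -/
def squareGrid (L : ℕ) : SimpleGraph (Fin L × Fin L) :=
  (SimpleGraph.pathGraph L).boxProd (SimpleGraph.pathGraph L)

open Classical in
/-- The set of all (labelled, simple) `d`-regular graphs on the vertex set `Fin n`. -/
def regularGraphs (n d : ℕ) : Set (SimpleGraph (Fin n)) :=
  {G | G.IsRegularOfDegree d}

/-- The probability that a uniformly random `d`-regular graph on the vertex set `Fin n` has the
property `P`: the proportion of the `d`-regular graphs that satisfy `P`.  It is meaningful when there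
is such a graph, that is, when `d < n` (or `n = d = 0`) and `n * d` is even. -/
noncomputable def regularProb (n d : ℕ) (P : SimpleGraph (Fin n) → Prop) : ℝ :=
  ((regularGraphs n d ∩ {G | P G}).ncard : ℝ) / ((regularGraphs n d).ncard : ℝ)

/-! The proof is the second moment method. Let X count the injective maps of the grid onto an
induced copy in G, and write p = d/n, v = L², and e for the number of grid edges. By Cauchy–Schwarz,
P(X > 0) ≥ (E X)² / E(X²), so it is enough that this ratio tends to 1; `le_regularProb` is the
quantitative form.

The probability that prescribed edges all lie in G is found one edge at a time by switching. By
`card_regExt_insert_mul_le` and `card_regExt_sub_mul_le`, each further edge costs a factor p up to a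
relative error ε = O(1/d + d/n). Since e ≤ 2v, the accumulated error vanishes once v/d and vd/n tend
to 0. A copy fails to be induced only if one of at most v² further pairs is an edge; this costs a
relative error of about v²p, which is o(1) because v = o(n^((1-c)/2)).

For E(X²), two copies φ and ψ that share k edges contribute about p^(2e-k), so the average of
(1/p)^k over a random map ψ must be 1 + o(1). Directed rightwards and upwards, the grid is acyclic
with in- and out-degrees at most two, so the vertices of ψ can be averaged out one by one from the
top (`sum_prod_arcs_le`). A vertex completes at most two shared arcs, which gains at most 1/p² =
n²/d², and it does so at boundedly many places; this is harmless beside the n possible places as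
soon as 16n ≤ d², and here c > 1/2 enters. The resulting bound (1 + 4v/n)^v is at most exp(4v²/n),
which tends to 1. -/

/-- The edge sets of the `d`-regular graphs on `V`. -/
def regSets (V : Type*) [Fintype V] [DecidableEq V] (d : ℕ) : Finset (Finset (Sym2 V)) :=
  Finset.univ.filter fun E => (∀ e ∈ E, ¬ e.IsDiag) ∧ ∀ u, (E.filter (u ∈ ·)).card = d

/-- The edge sets of the `d`-regular graphs on `V` that contain all edges of `S`. -/
def regExt {V : Type*} [Fintype V] [DecidableEq V] (d : ℕ) (S : Finset (Sym2 V)) :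
    Finset (Finset (Sym2 V)) :=
  (regSets V d).filter (S ⊆ ·)

/-- The neighbours of `u` in the graph with edge set `E`. -/
def nbrs {V : Type*} [Fintype V] [DecidableEq V] (E : Finset (Sym2 V)) (u : V) : Finset V :=
  Finset.univ.filter fun w => s(u, w) ∈ E

/-- The ordered pairs that span an edge of `E`. -/
def darts {V : Type*} [Fintype V] [DecidableEq V] (E : Finset (Sym2 V)) : Finset (V × V) :=
  Finset.univ.filter fun z => s(z.1, z.2) ∈ E

/-- The ordered edges `(z, w)` of `E` outside `S` with `z` outside the closed neighbourhood of `x`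
and `w` outside that of `y`. -/
def farDarts {V : Type*} [Fintype V] [DecidableEq V] (E S : Finset (Sym2 V)) (x y : V) :
    Finset (V × V) :=
  Finset.univ.filter fun z => s(z.1, z.2) ∈ E ∧ s(z.1, z.2) ∉ S ∧ z.1 ≠ x ∧ s(x, z.1) ∉ E ∧
    z.2 ≠ y ∧ s(y, z.2) ∉ E

/-! ### Switchings in regular graphs. -/

section Switching

variable {V : Type*} [Fintype V] [DecidableEq V]

lemma card_nbrs (E : Finset (Sym2 V)) (u : V) : (nbrs E u).card = (E.filter (u ∈ ·)).card := by
  rw [← Finset.card_image_of_injective (f := fun w => s(u, w)) (nbrs E u)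
    (fun a b h => Sym2.congr_right.mp h)]
  congr 1
  ext e
  simp only [nbrs, Finset.mem_image, Finset.mem_filter, Finset.mem_univ, true_and]
  constructor
  · rintro ⟨w, hw, rfl⟩
    exact ⟨hw, Sym2.mem_mk_left _ _⟩
  · rintro ⟨he, hu⟩
    obtain ⟨w, rfl⟩ := hu
    exact ⟨w, he, rfl⟩

lemma card_nbrs_of_mem {d : ℕ} {E : Finset (Sym2 V)} (hE : E ∈ regSets V d) (u : V) :
    (nbrs E u).card = d := by
  rw [card_nbrs]
  exact (Finset.mem_filter.mp hE).2.2 u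

lemma ne_of_mem_regSets {d : ℕ} {E : Finset (Sym2 V)} (hE : E ∈ regSets V d) {a b : V}
    (h : s(a, b) ∈ E) : a ≠ b := fun hab =>
  (Finset.mem_filter.mp hE).2.1 _ h (Sym2.mk_isDiag_iff.mpr hab)

lemma card_darts_filter_fst (E : Finset (Sym2 V)) (A : Finset V) :
    ((darts E).filter (·.1 ∈ A)).card = ∑ x ∈ A, (nbrs E x).card := by
  rw [← Finset.card_sigma]
  refine Finset.card_bij' (fun z _ => ⟨z.1, z.2⟩) (fun z _ => (z.1, z.2)) ?_ ?_ ?_ ?_ <;>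
  simp +contextual [darts, nbrs]

lemma card_darts_filter_snd (E : Finset (Sym2 V)) (A : Finset V) :
    ((darts E).filter (·.2 ∈ A)).card = ∑ x ∈ A, (nbrs E x).card := by
  rw [← card_darts_filter_fst]
  refine Finset.card_bij' (fun z _ => (z.2, z.1)) (fun z _ => (z.2, z.1)) ?_ ?_ ?_ ?_ <;>
  simp +contextual [darts, Sym2.eq_swap]

lemma card_darts {d : ℕ} {E : Finset (Sym2 V)} (hE : E ∈ regSets V d) :
    (darts E).card = Fintype.card V * d := by
  have h := card_darts_filter_fst E Finset.univ
  simp only [Finset.mem_univ, Finset.filter_true] at h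
  rw [h, Finset.sum_congr rfl fun x _ => card_nbrs_of_mem hE x]
  simp

lemma card_darts_le (S : Finset (Sym2 V)) : (darts S).card ≤ 2 * S.card := by
  refine Finset.card_le_mul_card_image_of_maps_to (f := fun z : V × V => s(z.1, z.2))
    (fun z hz => ?_) 2 fun e _ => ?_
  · simpa [darts] using hz
  · induction e with
    | _ a b =>
      refine (Finset.card_le_card (t := {(a, b), (b, a)}) fun z hz => ?_).trans
        Finset.card_le_two
      have := (Finset.mem_filter.mp hz).2
      obtain ⟨z1, z2⟩ := z
      simpa using this

/-- Of the nd darts, at most d(d + 1) start in the closed neighbourhood of `x`, as many end in that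
of `y`, and at most 2|S| come from `S`. So almost every dart is available for a switching. -/
lemma card_farDarts {d : ℕ} {E : Finset (Sym2 V)} (hE : E ∈ regSets V d) (S : Finset (Sym2 V))
    (x y : V) :
    Fintype.card V * d ≤ (farDarts E S x y).card + (2 * (d * (d + 1)) + 2 * S.card) := by
  have hsum : ∀ x, ∑ z ∈ insert x (nbrs E x), (nbrs E z).card ≤ d * (d + 1) := fun x => by
    rw [Finset.sum_congr rfl fun z _ => card_nbrs_of_mem hE z, Finset.sum_const, smul_eq_mul,
      mul_comm]
    refine Nat.mul_le_mul_left _ ((Finset.card_insert_le _ _).trans ?_)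
    rw [card_nbrs_of_mem hE]
  have hsub : darts E ⊆ farDarts E S x y ∪ (((darts E).filter (·.1 ∈ insert x (nbrs E x)) ∪
      (darts E).filter (·.2 ∈ insert y (nbrs E y))) ∪ darts S) := by
    intro z hz
    simp only [farDarts, darts, nbrs, Finset.mem_union, Finset.mem_filter, Finset.mem_univ,
      true_and, Finset.mem_insert] at hz ⊢
    tauto
  have h1 := card_darts_filter_fst E (insert x (nbrs E x))
  have h2 := card_darts_filter_snd E (insert y (nbrs E y))
  have := hsum x
  have := hsum y
  have := card_darts_le S
  calc Fintype.card V * d = (darts E).card := (card_darts hE).symm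
    _ ≤ _ := Finset.card_le_card hsub
    _ ≤ _ := (Finset.card_union_le _ _).trans (Nat.add_le_add_left
      ((Finset.card_union_le _ _).trans (Nat.add_le_add_right (Finset.card_union_le _ _) _)) _)
    _ ≤ _ := by omega

/-- Every vertex loses as many edges as it gains, so all degrees survive the exchange of `P` for
`Q`. -/
lemma switch_mem_regSets {d : ℕ} {E P Q : Finset (Sym2 V)} (hE : E ∈ regSets V d) (hP : P ⊆ E)
    (hQ : Disjoint Q E) (hQd : ∀ e ∈ Q, ¬ e.IsDiag)
    (hPQ : ∀ u, (P.filter (u ∈ ·)).card = (Q.filter (u ∈ ·)).card) :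
    (E \ P) ∪ Q ∈ regSets V d := by
  simp only [regSets, Finset.mem_filter, Finset.mem_univ, true_and] at hE ⊢
  refine ⟨fun e he => ?_, fun u => ?_⟩
  · rcases Finset.mem_union.mp he with h | h
    · exact hE.1 e (Finset.sdiff_subset h)
    · exact hQd e h
  · have hd : Disjoint ((E \ P).filter (u ∈ ·)) (Q.filter (u ∈ ·)) :=
      Finset.disjoint_filter_filter (hQ.symm.mono_left Finset.sdiff_subset)
    have hd' : Disjoint ((E \ P).filter (u ∈ ·)) (P.filter (u ∈ ·)) :=
      Finset.disjoint_filter_filter Finset.sdiff_disjoint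
    rw [Finset.filter_union, Finset.card_union_of_disjoint hd, ← hPQ u,
      ← Finset.card_union_of_disjoint hd', ← Finset.filter_union,
      Finset.sdiff_union_of_subset hP, hE.2 u]

/-- A switching is undone by removing `Q` and restoring `P`. Hence a switched graph together with
the vertices that determine `P` and `Q` recovers the original graph. -/
lemma switch_injective {α : Type*} [DecidableEq α] {E E' P Q : Finset α} (hP : P ⊆ E)
    (hQ : Disjoint Q E)
    (hP' : P ⊆ E') (hQ' : Disjoint Q E') (h : (E \ P) ∪ Q = (E' \ P) ∪ Q) : E = E' := by
  have key : ∀ F : Finset α, P ⊆ F → Disjoint Q F → (((F \ P) ∪ Q) \ Q) ∪ P = F := by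
    intro F hPF hQF
    ext e
    have h1 := @hPF e
    have h2 : e ∈ Q → e ∉ F := fun he => Finset.disjoint_left.mp hQF he
    simp only [Finset.mem_union, Finset.mem_sdiff]
    tauto
  rw [← key E hP hQ, h, key E' hP' hQ']

lemma ite_mem_mk {α : Type*} [DecidableEq α] {a b : α} (hab : a ≠ b) (u : α) :
    (if u ∈ s(a, b) then 1 else 0) = (if u = a then 1 else 0) + (if u = b then 1 else 0) := by
  simp only [Sym2.mem_iff]
  split_ifs <;> simp_all

lemma mem_regExt {d : ℕ} {S E : Finset (Sym2 V)} :
    E ∈ regExt d S ↔ E ∈ regSets V d ∧ S ⊆ E := Finset.mem_filter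

/-- Upper bound for the number of regular graphs containing one more edge, by switching the edges
`ab`, `xy` for `ax`, `by`. -/
lemma card_regExt_insert_mul_le {d M : ℕ} {S : Finset (Sym2 V)} {a b : V} (hab : s(a, b) ∉ S)
    (hM : M + (2 * (d * (d + 1)) + 2 * S.card) ≤ Fintype.card V * d) :
    (regExt d (insert s(a, b) S)).card * M ≤ (regExt d S).card * d ^ 2 := by
  let T : Finset (Σ _ : Finset (Sym2 V), V × V) :=
    (regExt d (insert s(a, b) S)).sigma fun E => farDarts E S a b
  let T' : Finset (Σ _ : Finset (Sym2 V), V × V) :=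
    (regExt d S).sigma fun E => nbrs E a ×ˢ nbrs E b
  have hT : (regExt d (insert s(a, b) S)).card * M ≤ T.card := by
    rw [Finset.card_sigma, ← smul_eq_mul]
    refine Finset.card_nsmul_le_sum _ _ _ fun E hE => ?_
    have := card_farDarts (mem_regExt.mp hE).1 S a b
    omega
  have hT' : T'.card = (regExt d S).card * d ^ 2 := by
    rw [Finset.card_sigma, ← smul_eq_mul]
    refine Finset.sum_const_nat fun E hE => ?_
    have := fun u => card_nbrs_of_mem (mem_regExt.mp hE).1 u
    rw [Finset.card_product, this, this, sq]
  rw [← hT']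
  -- The pair (x, y) is kept. In the new graph x is a neighbour of a and y one of b, so each image
  -- graph is hit at most d² times.
  refine hT.trans (Finset.card_le_card_of_injOn
    (fun t => ⟨(t.1 \ {s(a, b), s(t.2.1, t.2.2)}) ∪ {s(a, t.2.1), s(b, t.2.2)}, t.2⟩) ?_ ?_)
  · rintro ⟨E, x, y⟩ ht
    simp only [T, Finset.coe_sigma, Set.mem_sigma_iff, Finset.mem_coe, mem_regExt, farDarts,
      Finset.mem_filter, Finset.mem_univ, true_and, Finset.insert_subset_iff] at ht
    obtain ⟨⟨hE, habE, hSE⟩, hxy, hxyS, hxa, hax, hyb, hby⟩ := ht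
    have hne : a ≠ b := ne_of_mem_regSets hE habE
    have hxy' : x ≠ y := ne_of_mem_regSets hE hxy
    have hya : y ≠ a := by rintro rfl; exact hby (Sym2.eq_swap ▸ habE)
    have hxb : x ≠ b := by rintro rfl; exact hax habE
    have hmem : (E \ {s(a, b), s(x, y)}) ∪ {s(a, x), s(b, y)} ∈ regSets V d := by
      refine switch_mem_regSets hE ?_ ?_ ?_ fun u => ?_
      · simp [Finset.insert_subset_iff, habE, hxy]
      · simp [hax, hby]
      · simp [hxa.symm, hyb.symm]
      · have h1 : s(a, b) ≠ s(x, y) := by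
          simp only [ne_eq, Sym2.eq_iff]; tauto
        have h2 : s(a, x) ≠ s(b, y) := by
          simp only [ne_eq, Sym2.eq_iff]; tauto
        rw [Finset.card_filter, Finset.card_filter, Finset.sum_pair h1, Finset.sum_pair h2,
          ite_mem_mk hne, ite_mem_mk hxy', ite_mem_mk hxa.symm, ite_mem_mk hyb.symm]
        ring
    simp only [T', Finset.coe_sigma, Set.mem_sigma_iff, Finset.mem_coe, mem_regExt,
      Finset.mem_product, nbrs, Finset.mem_filter, Finset.mem_univ, true_and]
    refine ⟨⟨hmem, fun e he => ?_⟩, ?_, ?_⟩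
    · refine Finset.mem_union_left _ (Finset.mem_sdiff.mpr ⟨hSE he, ?_⟩)
      simp only [Finset.mem_insert, Finset.mem_singleton, not_or]
      exact ⟨fun h => hab (h ▸ he), fun h => hxyS (h ▸ he)⟩
    · simp
    · simp
  · rintro ⟨E, x, y⟩ ht ⟨E', x', y'⟩ ht' h
    simp only [Sigma.mk.injEq, heq_eq_eq, Prod.mk.injEq] at h
    obtain ⟨h, rfl, rfl⟩ := h
    simp only [T, Finset.coe_sigma, Set.mem_sigma_iff, Finset.mem_coe, mem_regExt, farDarts,
      Finset.mem_filter, Finset.mem_univ, true_and, Finset.insert_subset_iff] at ht ht'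
    have := switch_injective (E := E) (E' := E') ?_ ?_ ?_ ?_ h
    · rw [this]
    all_goals simp [Finset.insert_subset_iff, ht, ht']

/-- Lower bound for the number of regular graphs containing one more edge, by switching the edges
`ax`, `by`, `zw` for `ab`, `xz`, `yw`. -/
lemma card_regExt_sub_mul_le {d M k : ℕ} {S : Finset (Sym2 V)} {a b : V} (hne : a ≠ b)
    (ha : (nbrs S a).card ≤ k) (hb : (nbrs S b).card ≤ k)
    (hM : M + (2 * (d * (d + 1)) + 2 * S.card) ≤ Fintype.card V * d) :
    ((regExt d S).card - (regExt d (insert s(a, b) S)).card) * ((d - k) * ((d - (k + 1)) * M)) ≤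
      (regExt d (insert s(a, b) S)).card * (Fintype.card V * d) ^ 2 := by
  -- Joining x to y directly would need xy to be a non-edge, which can fail for every choice of
  -- neighbours x of a and y of b. The detour through a third edge zw avoids this. Only edges
  -- outside `S` are removed, and x = y is excluded.
  let T : Finset (Σ _ : Finset (Sym2 V), Σ _ : V, Σ _ : V, V × V) :=
    (regExt d S \ regExt d (insert s(a, b) S)).sigma fun E =>
      (nbrs E a \ nbrs S a).sigma fun x => ((nbrs E b \ nbrs S b).erase x).sigma fun y =>
        farDarts E S x y
  let T' : Finset (Σ _ : Finset (Sym2 V), (V × V) × (V × V)) :=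
    (regExt d (insert s(a, b) S)).sigma fun E => darts E ×ˢ darts E
  have hsub : regExt d (insert s(a, b) S) ⊆ regExt d S := fun E hE => by
    rw [mem_regExt] at hE ⊢
    exact ⟨hE.1, (Finset.subset_insert _ _).trans hE.2⟩
  have hT : ((regExt d S).card - (regExt d (insert s(a, b) S)).card) *
      ((d - k) * ((d - (k + 1)) * M)) ≤ T.card := by
    rw [← Finset.card_sdiff_of_subset hsub, Finset.card_sigma, ← smul_eq_mul]
    refine Finset.card_nsmul_le_sum _ _ _ fun E hE => ?_
    have hE' := (mem_regExt.mp (Finset.mem_sdiff.mp hE).1).1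
    have hd := fun u => card_nbrs_of_mem hE' u
    have hsd : ∀ u, d - (nbrs S u).card ≤ (nbrs E u \ nbrs S u).card := fun u => by
      rw [← hd u]; exact Finset.le_card_sdiff _ _
    rw [Finset.card_sigma]
    refine (Nat.mul_le_mul_right _ ((Nat.sub_le_sub_left ha d).trans (hsd a))).trans ?_
    rw [← smul_eq_mul]
    refine Finset.card_nsmul_le_sum _ _ _ fun x hx => ?_
    rw [Finset.card_sigma]
    have h1 : d - (k + 1) ≤ ((nbrs E b \ nbrs S b).erase x).card := by
      have h1 := hsd b
      have h2 := Finset.pred_card_le_card_erase (s := nbrs E b \ nbrs S b) (a := x)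
      omega
    refine (Nat.mul_le_mul_right _ h1).trans ?_
    rw [← smul_eq_mul]
    refine Finset.card_nsmul_le_sum _ _ _ fun y hy => ?_
    have := card_farDarts hE' S x y
    omega
  have hT' : T'.card = (regExt d (insert s(a, b) S)).card * (Fintype.card V * d) ^ 2 := by
    rw [Finset.card_sigma, ← smul_eq_mul]
    refine Finset.sum_const_nat fun E hE => ?_
    rw [Finset.card_product, card_darts (mem_regExt.mp hE).1, sq]
  have hTmem : ∀ {E : Finset (Sym2 V)} {x y z w : V}, (⟨E, x, y, z, w⟩ : Σ _ : Finset (Sym2 V),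
      Σ _ : V, Σ _ : V, V × V) ∈ T → (E ∈ regSets V d ∧ S ⊆ E ∧ s(a, b) ∉ E) ∧
      (s(a, x) ∈ E ∧ s(a, x) ∉ S) ∧ (y ≠ x ∧ s(b, y) ∈ E ∧ s(b, y) ∉ S) ∧
      s(z, w) ∈ E ∧ s(z, w) ∉ S ∧ z ≠ x ∧ s(x, z) ∉ E ∧ w ≠ y ∧ s(y, w) ∉ E := by
    intro E x y z w ht
    simp only [T, Finset.mem_sigma, Finset.mem_sdiff, mem_regExt, farDarts, nbrs,
      Finset.mem_erase, Finset.mem_filter, Finset.mem_univ, true_and,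
      Finset.insert_subset_iff] at ht
    tauto
  rw [← hT']
  refine hT.trans (Finset.card_le_card_of_injOn
    (fun t => ⟨(t.1 \ {s(a, t.2.1), s(b, t.2.2.1), s(t.2.2.2.1, t.2.2.2.2)}) ∪
      {s(a, b), s(t.2.1, t.2.2.2.1), s(t.2.2.1, t.2.2.2.2)},
      ((t.2.1, t.2.2.2.1), (t.2.2.1, t.2.2.2.2))⟩) ?_ ?_)
  · rintro ⟨E, x, y, z, w⟩ ht
    obtain ⟨⟨hE, hSE, habE⟩, ⟨hax, haxS⟩, ⟨hyx, hby, hbyS⟩, hzw, hzwS, hzx, hxz, hwy, hyw⟩ :=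
      hTmem ht
    have hax' : a ≠ x := ne_of_mem_regSets hE hax
    have hby' : b ≠ y := ne_of_mem_regSets hE hby
    have hzw' : z ≠ w := ne_of_mem_regSets hE hzw
    have hay : a ≠ y := by rintro rfl; exact habE (Sym2.eq_swap ▸ hby)
    have hbx : b ≠ x := by rintro rfl; exact habE hax
    have hza : z ≠ a := by rintro rfl; exact hxz (Sym2.eq_swap ▸ hax)
    have hwb : w ≠ b := by rintro rfl; exact hyw (Sym2.eq_swap ▸ hby)
    have hmem : (E \ {s(a, x), s(b, y), s(z, w)}) ∪ {s(a, b), s(x, z), s(y, w)} ∈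
        regSets V d := by
      refine switch_mem_regSets hE ?_ ?_ ?_ fun u => ?_
      · simp [Finset.insert_subset_iff, hax, hby, hzw]
      · simp [habE, hxz, hyw]
      · simp [hne, hzx.symm, hwy.symm]
      · have h1 : s(a, x) ∉ ({s(b, y), s(z, w)} : Finset (Sym2 V)) := by
          simp only [Finset.mem_insert, Finset.mem_singleton, Sym2.eq_iff]
          grind
        have h2 : s(b, y) ∉ ({s(z, w)} : Finset (Sym2 V)) := by
          simp only [Finset.mem_singleton, Sym2.eq_iff]
          grind
        have h3 : s(a, b) ∉ ({s(x, z), s(y, w)} : Finset (Sym2 V)) := by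
          simp only [Finset.mem_insert, Finset.mem_singleton, Sym2.eq_iff]
          grind
        -- The new edges must be distinct for the degree count. The crossed coincidence x = w, z = y
        -- would make xz the old edge zw, although xz is not in E.
        have h4 : s(x, z) ∉ ({s(y, w)} : Finset (Sym2 V)) := by
          simp only [Finset.mem_singleton, Sym2.eq_iff, not_or, not_and]
          refine ⟨fun h => absurd h.symm hyx, ?_⟩
          rintro rfl rfl
          exact hxz (Sym2.eq_swap ▸ hzw)
        rw [Finset.card_filter, Finset.card_filter, Finset.sum_insert h1, Finset.sum_insert h2,
          Finset.sum_insert h3, Finset.sum_insert h4, Finset.sum_singleton, Finset.sum_singleton,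
          ite_mem_mk hne, ite_mem_mk hax', ite_mem_mk hby', ite_mem_mk hzw',
          ite_mem_mk hzx.symm, ite_mem_mk hwy.symm]
        ring
    simp only [T', Finset.coe_sigma, Set.mem_sigma_iff, Finset.mem_coe, mem_regExt,
      Finset.mem_product, darts, Finset.mem_filter, Finset.mem_univ, true_and]
    refine ⟨⟨hmem, Finset.insert_subset (by simp) fun e he => ?_⟩, by simp, by simp⟩
    refine Finset.mem_union_left _ (Finset.mem_sdiff.mpr ⟨hSE he, ?_⟩)
    simp only [Finset.mem_insert, Finset.mem_singleton, not_or]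
    exact ⟨fun h => haxS (h ▸ he), fun h => hbyS (h ▸ he), fun h => hzwS (h ▸ he)⟩
  · rintro ⟨E, x, y, z, w⟩ ht ⟨E', x', y', z', w'⟩ ht' h
    simp only [Sigma.mk.injEq, heq_eq_eq, Prod.mk.injEq] at h
    obtain ⟨h, ⟨rfl, rfl⟩, rfl, rfl⟩ := h
    have ht := hTmem ht
    have ht' := hTmem ht'
    have := switch_injective (E := E) (E' := E') ?_ ?_ ?_ ?_ h
    · rw [this]
    all_goals simp [Finset.insert_subset_iff, ht, ht']

end Switching

/-! ### Probability that prescribed edges are present. -/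

section EdgeProbability

variable {V : Type*} [Fintype V] [DecidableEq V]

lemma regExt_empty (d : ℕ) : regExt d (∅ : Finset (Sym2 V)) = regSets V d := by
  simp [regExt]

/-- If `S` is not too large, then a fixed set of edges `S` lies in a random `d`-regular graph with
probability at most `(p / (1 - ε)) ^ |S|`. -/
lemma card_regExt_le {d m : ℕ} {ε : ℝ} (hd : 0 < d) (hV : 0 < Fintype.card V) (hε : ε < 1)
    (hm : (2 * (d * (d + 1)) + 2 * m : ℝ) ≤ ε * (Fintype.card V * d))
    (S : Finset (Sym2 V)) (hS : S.card ≤ m) :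
    ((regExt d S).card : ℝ) ≤
      ((d / Fintype.card V : ℝ) / (1 - ε)) ^ S.card * (regSets V d).card := by
  induction S using Finset.induction_on with
  | empty => simp [regExt_empty]
  | insert e S he ih =>
    rw [Finset.card_insert_of_notMem he] at hS ⊢
    have ih := ih (by omega)
    have hnd : (0 : ℝ) < Fintype.card V * d := by positivity
    have hm' : 2 * (d * (d + 1)) + 2 * S.card ≤ Fintype.card V * d := by
      have h1 : (2 * (d * (d + 1)) + 2 * m : ℝ) ≤ Fintype.card V * d :=
        hm.trans (by nlinarith)
      have h2 : 2 * (d * (d + 1)) + 2 * m ≤ Fintype.card V * d := by exact_mod_cast h1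
      omega
    obtain ⟨M, hM⟩ := Nat.exists_eq_add_of_le' hm'
    have hMR : (Fintype.card V * d * (1 - ε) : ℝ) ≤ M := by
      have h1 : (Fintype.card V * d : ℝ) = M + (2 * (d * (d + 1)) + 2 * S.card) := by
        exact_mod_cast hM
      have h2 : (S.card : ℝ) ≤ m := by exact_mod_cast (by omega : S.card ≤ m)
      linarith
    have key : ((regExt d (insert e S)).card : ℝ) * M ≤ (regExt d S).card * (d : ℝ) ^ 2 := by
      induction e with
      | _ a b => exact_mod_cast card_regExt_insert_mul_le he hM.ge
    have hε' : 0 < 1 - ε := by linarith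
    have h3 : ((regExt d (insert e S)).card : ℝ) ≤
        ((d / Fintype.card V : ℝ) / (1 - ε)) * (regExt d S).card := by
      have h4 : ((regExt d (insert e S)).card : ℝ) * (Fintype.card V * d * (1 - ε)) ≤
          (regExt d S).card * (d : ℝ) ^ 2 :=
        (mul_le_mul_of_nonneg_left hMR (by positivity)).trans key
      rw [div_div, div_mul_eq_mul_div, le_div_iff₀ (by positivity)]
      have hd' : (0 : ℝ) < d := by exact_mod_cast hd
      refine le_of_mul_le_mul_right ?_ hd'
      linarith
    calc ((regExt d (insert e S)).card : ℝ)
        ≤ ((d / Fintype.card V : ℝ) / (1 - ε)) * (regExt d S).card := h3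
      _ ≤ ((d / Fintype.card V : ℝ) / (1 - ε)) *
          (((d / Fintype.card V : ℝ) / (1 - ε)) ^ S.card * (regSets V d).card) := by gcongr
      _ = _ := by ring

lemma nbrs_mono {S T : Finset (Sym2 V)} (h : S ⊆ T) (u : V) : nbrs S u ⊆ nbrs T u :=
  Finset.monotone_filter_right _ fun _ _ hw => h hw

/-- With r = p(1 - δ)(1 - η), the switching inequality (R - A)r ≤ A gives A ≥ rR/(1 + r) ≥ r(1 -
r)R, and r(1 - r) ≥ p(1 - δ - η - p) when the last factor is positive; otherwise p(1 - ε) ≤ 0. -/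
lemma mul_le_of_sub_mul_le {p δ η ε A R : ℝ} (hp0 : 0 < p) (hp1 : p ≤ 1) (hδ : 0 ≤ δ)
    (hη : 0 ≤ η) (hε : δ + p + η ≤ ε) (hε1 : ε ≤ 1) (hA : 0 ≤ A) (hAR : A ≤ R)
    (h : (R - A) * (p * ((1 - δ) * (1 - η))) ≤ A) : p * (1 - ε) * R ≤ A := by
  have h5 : 0 ≤ 1 - δ := by linarith
  have h6 : 0 ≤ 1 - η := by linarith
  have h56 : (1 - δ) * (1 - η) ≤ 1 := mul_le_one₀ (by linarith) h6 (by linarith)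
  have hrp' : p * (1 - δ - η) ≤ p * ((1 - δ) * (1 - η)) :=
    mul_le_mul_of_nonneg_left (by nlinarith) hp0.le
  have hr0 : 0 ≤ p * ((1 - δ) * (1 - η)) := by positivity
  have hrp : p * ((1 - δ) * (1 - η)) ≤ p := mul_le_of_le_one_right hp0.le h56
  generalize p * ((1 - δ) * (1 - η)) = r at *
  have h7 : p * (1 - ε) ≤ r * (1 - r) := by
    have h8 : p * (1 - ε) ≤ p * (1 - δ - η) - p * p := by nlinarith
    by_cases hneg : 1 - δ - η - p ≤ 0
    · nlinarith
    · nlinarith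
  have hR0 : 0 ≤ R := hA.trans hAR
  have h8 : r * (1 - r) * R ≤ A := by
    have h9 : r * R ≤ A * (1 + r) := by linarith
    have h10 := mul_le_mul_of_nonneg_left h9 (by linarith : 0 ≤ 1 - r)
    nlinarith [mul_nonneg hA (sq_nonneg r)]
  exact (mul_le_mul_of_nonneg_right h7 hR0).trans h8

/-- If `S` is not too large and has maximum degree at most `4`, then it lies in a random
`d`-regular graph with probability at least `(p * (1 - ε)) ^ |S|`. -/
lemma le_card_regExt {d m : ℕ} {ε : ℝ} (hd : 5 ≤ d) (hV : 0 < Fintype.card V)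
    (hdV : d ≤ Fintype.card V) (hε : ε ≤ 1)
    (hm : (9 / d + d / Fintype.card V : ℝ) +
      (2 * (d * (d + 1)) + 2 * m : ℝ) / (Fintype.card V * d) ≤ ε)
    (S : Finset (Sym2 V)) (hS : S.card ≤ m) (hdiag : ∀ e ∈ S, ¬ e.IsDiag)
    (hdeg : ∀ u, (nbrs S u).card ≤ 4) :
    ((d / Fintype.card V : ℝ) * (1 - ε)) ^ S.card * (regSets V d).card ≤ (regExt d S).card := by
  induction S using Finset.induction_on with
  | empty => simp [regExt_empty]
  | insert e S he ih =>
    rw [Finset.card_insert_of_notMem he] at hS ⊢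
    have hdeg' : ∀ u, (nbrs S u).card ≤ 4 := fun u =>
      (Finset.card_le_card (nbrs_mono (Finset.subset_insert _ _) u)).trans (hdeg u)
    have ih := ih (by omega) (fun e he => hdiag e (Finset.mem_insert_of_mem he)) hdeg'
    have hd0 : (0 : ℝ) < d := by exact_mod_cast (by omega : 0 < d)
    have hd5 : (5 : ℝ) ≤ d := by exact_mod_cast hd
    have hV0 : (0 : ℝ) < Fintype.card V := by exact_mod_cast hV
    have hdV' : (d : ℝ) ≤ Fintype.card V := by exact_mod_cast hdV
    have hnd : (0 : ℝ) < Fintype.card V * d := by positivity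
    set η : ℝ := (2 * (d * (d + 1)) + 2 * m : ℝ) / (Fintype.card V * d) with hη
    set p : ℝ := d / Fintype.card V with hp
    have hp0 : 0 < p := by positivity
    have hp1 : p ≤ 1 := (div_le_one hV0).mpr hdV'
    have h9 : (0 : ℝ) < 9 / d := by positivity
    have hη0 : 0 ≤ η := by positivity
    have hη1 : η ≤ 1 := by linarith
    have hηm : (2 * (d * (d + 1)) + 2 * m : ℝ) = η * (Fintype.card V * d) := by
      rw [hη]; field_simp
    have hm' : 2 * (d * (d + 1)) + 2 * S.card ≤ Fintype.card V * d := by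
      have h1 : (2 * (d * (d + 1)) + 2 * m : ℝ) ≤ Fintype.card V * d := by
        rw [hηm]; nlinarith
      have h2 : 2 * (d * (d + 1)) + 2 * m ≤ Fintype.card V * d := by exact_mod_cast h1
      omega
    obtain ⟨M, hM⟩ := Nat.exists_eq_add_of_le' hm'
    have hMR : (Fintype.card V * d * (1 - η) : ℝ) ≤ M := by
      have h1 : (Fintype.card V * d : ℝ) = M + (2 * (d * (d + 1)) + 2 * S.card) := by
        exact_mod_cast hM
      have h2 : (S.card : ℝ) ≤ m := by exact_mod_cast (by omega : S.card ≤ m)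
      linarith
    have hle : (regExt d (insert e S)).card ≤ (regExt d S).card := by
      refine Finset.card_le_card fun E hE => ?_
      rw [mem_regExt] at hE ⊢
      exact ⟨hE.1, (Finset.subset_insert _ _).trans hE.2⟩
    have key : ((regExt d S).card - (regExt d (insert e S)).card : ℝ) *
        ((d - 4) * ((d - 5) * M)) ≤
          (regExt d (insert e S)).card * (Fintype.card V * d : ℝ) ^ 2 := by
      have hd' := hdiag e (Finset.mem_insert_self _ _)
      induction e with
      | _ a b =>
        have := card_regExt_sub_mul_le (k := 4) (fun h => hd' (Sym2.mk_isDiag_iff.mpr h))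
          (hdeg' a) (hdeg' b) hM.ge
        have h' : (((regExt d S).card - (regExt d (insert s(a, b) S)).card : ℕ) : ℝ) *
            (((d - 4 : ℕ) : ℝ) * (((d - (4 + 1) : ℕ) : ℝ) * M)) ≤
          (regExt d (insert s(a, b) S)).card * (Fintype.card V * d : ℝ) ^ 2 := by
          exact_mod_cast this
        rw [Nat.cast_sub hle, Nat.cast_sub (by omega), Nat.cast_sub (by omega)] at h'
        push_cast at h'
        exact h'
    have hAR : ((regExt d (insert e S)).card : ℝ) ≤ (regExt d S).card := by exact_mod_cast hle
    have hA0 : (0 : ℝ) ≤ (regExt d (insert e S)).card := Nat.cast_nonneg _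
    generalize ((regExt d S).card : ℝ) = R at *
    generalize ((regExt d (insert e S)).card : ℝ) = A at *
    have h1 : (R - A) * (p * ((1 - 9 / d) * (1 - η))) ≤ A := by
      -- There are at least d - 4 choices for x outside `S` and d - 5 for y, which must also differ
      -- from x; their product is d² - 9d + 20.
      have hq : (d : ℝ) ^ 2 * (1 - 9 / d) ≤ (d - 4) * (d - 5) := by
        have : (d : ℝ) ^ 2 * (1 - 9 / d) = d ^ 2 - 9 * d := by field_simp
        rw [this]; nlinarith
      have h2 : (R - A) * ((d : ℝ) ^ 2 * (1 - 9 / d) * (Fintype.card V * d * (1 - η))) ≤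
          A * (Fintype.card V * d : ℝ) ^ 2 := by
        refine le_trans (mul_le_mul_of_nonneg_left ?_ (by linarith)) key
        rw [← mul_assoc ((d : ℝ) - 4)]
        refine mul_le_mul hq hMR ?_ ?_
        · exact mul_nonneg hnd.le (by linarith)
        · nlinarith
      refine le_of_mul_le_mul_right ?_ (by positivity : (0 : ℝ) < (Fintype.card V * d : ℝ) ^ 2)
      refine le_trans (le_of_eq ?_) h2
      rw [hp]
      field_simp
    have h3 : p * (1 - ε) * R ≤ A :=
      mul_le_of_sub_mul_le hp0 hp1 h9.le hη0 (by linarith) hε hA0 hAR h1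
    calc (p * (1 - ε)) ^ (S.card + 1) * (regSets V d).card
        = p * (1 - ε) * ((p * (1 - ε)) ^ S.card * (regSets V d).card) := by ring
      _ ≤ p * (1 - ε) * R := by
        refine mul_le_mul_of_nonneg_left ih (mul_nonneg hp0.le (by linarith))
      _ ≤ A := h3

end EdgeProbability

/-! ### Overlap of a random map with a fixed copy. -/

/-- One step of the overlap sum: `c j x` is `q` if `x` is one of the at most four neighbours of the
image of `j` and `1` otherwise, and `u j` tells whether the image of `j` lies in the set `U`. -/
lemma sum_mul_prod_le {ι α : Type*} [DecidableEq ι] [Fintype α] [DecidableEq α] {q : ℝ}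
    (hq : 1 ≤ q) (hqn : 16 * q ^ 2 ≤ Fintype.card α)
    (U : Finset α) (N : ι → Finset α) (u : ι → Prop) [DecidablePred u]
    (hN : ∀ j, (N j).card ≤ 4) (hNu : ∀ j, ¬ u j → N j = ∅)
    (I : Finset ι) (hI : I.card ≤ 2) :
    ∑ x, (if x ∈ U then 4 else 1) * ∏ j ∈ I, (if x ∈ N j then q else 1) ≤
      (Fintype.card α + 4 * U.card : ℝ) * ∏ j ∈ I, (if u j then 2 else 1) := by
  have h0 : ∑ x : α, (if x ∈ U then 4 else 1 : ℝ) ≤ Fintype.card α + 4 * U.card := by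
    calc ∑ x : α, (if x ∈ U then 4 else 1 : ℝ) ≤ ∑ x : α, (1 + if x ∈ U then 4 else 0 : ℝ) :=
          Finset.sum_le_sum fun x _ => by split_ifs <;> norm_num
      _ = Fintype.card α + 4 * U.card := by
          rw [Finset.sum_add_distrib, Finset.sum_ite_mem]
          simp [mul_comm]
  -- The at most four points of `N j` add at most 4 · 4q² ≤ n, which at worst doubles the sum. The
  -- square is what the case of two arcs needs.
  have h1 : ∀ j, ∑ x, (if x ∈ U then 4 else 1) * (if x ∈ N j then q else 1) ^ 2 ≤
      (Fintype.card α + 4 * U.card : ℝ) * (if u j then 2 else 1) := by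
    intro j
    by_cases hj : u j
    · calc ∑ x, (if x ∈ U then 4 else 1) * (if x ∈ N j then q else 1) ^ 2
          ≤ ∑ x, ((if x ∈ U then 4 else 1 : ℝ) + if x ∈ N j then 4 * q ^ 2 else 0) := by
            refine Finset.sum_le_sum fun x _ => ?_
            split_ifs <;> nlinarith
        _ ≤ (Fintype.card α + 4 * U.card) + 16 * q ^ 2 := by
            rw [Finset.sum_add_distrib, Finset.sum_ite_mem]
            refine add_le_add h0 ?_
            have : ((N j).card : ℝ) ≤ 4 := by exact_mod_cast hN j
            simp only [Finset.univ_inter, Finset.sum_const, nsmul_eq_mul]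
            nlinarith [sq_nonneg q]
        _ ≤ _ := by
            rw [if_pos hj]
            have : (0 : ℝ) ≤ U.card := by positivity
            linarith
    · simpa [hNu j hj, hj] using h0
  have hc1 : ∀ j x, (1 : ℝ) ≤ if x ∈ N j then q else 1 := fun j x => by split_ifs <;> linarith
  have hw0 : ∀ x, (0 : ℝ) ≤ if x ∈ U then 4 else 1 := fun x => by split_ifs <;> norm_num
  have hI' : I.card = 0 ∨ I.card = 1 ∨ I.card = 2 := by omega
  rcases hI' with hI | hI | hI
  · rw [Finset.card_eq_zero.mp hI]
    simpa using h0
  · obtain ⟨j, rfl⟩ := Finset.card_eq_one.mp hI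
    simp only [Finset.prod_singleton]
    refine le_trans (Finset.sum_le_sum fun x _ => mul_le_mul_of_nonneg_left ?_ (hw0 x)) (h1 j)
    nlinarith [hc1 j x]
  · obtain ⟨j, k, hjk, rfl⟩ := Finset.card_eq_two.mp hI
    simp only [Finset.prod_pair hjk]
    -- By ab ≤ (a² + b²)/2 the two arcs are treated separately.
    have h2 : ∑ x, (if x ∈ U then 4 else 1) *
        ((if x ∈ N j then q else 1) * (if x ∈ N k then q else 1)) ≤
        (∑ x, (if x ∈ U then 4 else 1) * (if x ∈ N j then q else 1) ^ 2 +
          ∑ x, (if x ∈ U then 4 else 1) * (if x ∈ N k then q else 1) ^ 2) / 2 := by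
      rw [← Finset.sum_add_distrib, Finset.sum_div]
      refine Finset.sum_le_sum fun x _ => ?_
      rw [← mul_add, mul_div_assoc]
      refine mul_le_mul_of_nonneg_left ?_ (hw0 x)
      nlinarith [sq_nonneg ((if x ∈ N j then q else 1) - (if x ∈ N k then q else 1))]
    refine h2.trans ?_
    have h3 := h1 j
    have h4 := h1 k
    have h5 : (0 : ℝ) ≤ Fintype.card α + 4 * U.card := by positivity
    split_ifs at h3 h4 ⊢ <;> linarith

/-- Resampling one coordinate of a uniformly random map leaves it uniform. This allows averaging
over one vertex with all others fixed. -/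
lemma card_mul_sum_eq_sum_update {W α : Type*} [Fintype W] [DecidableEq W] [Fintype α]
    (t : W) (F : (W → α) → ℝ) :
    (Fintype.card α : ℝ) * ∑ ψ, F ψ = ∑ ψ, ∑ x, F (Function.update ψ t x) := by
  have h := fun G : (W → α) → ℝ => Equiv.sum_comp (Equiv.funSplitAt t α).symm G
  rw [← h, ← h, Fintype.sum_prod_type, Fintype.sum_prod_type]
  have hu : ∀ (y x : α) (g : {j // j ≠ t} → α),
      Function.update ((Equiv.funSplitAt t α).symm (y, g)) t x =
        (Equiv.funSplitAt t α).symm (x, g) := by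
    intro y x g
    funext j
    by_cases hj : j = t
    · subst hj; simp [Equiv.funSplitAt]
    · simp [Equiv.funSplitAt, hj]
  simp_rw [hu]
  rw [Finset.sum_const, Finset.card_univ, nsmul_eq_mul]
  congr 1
  exact Finset.sum_comm

section OverlapSum

variable {W α : Type*} [Fintype W] [DecidableEq W] [Fintype α] [DecidableEq α]

/-- The exponential moment of the number of arcs of `O` that a random map sends to `Γ`. -/
lemma sum_prod_arcs_le {q : ℝ} (hq : 1 ≤ q) (hqn : 16 * q ^ 2 ≤ Fintype.card α)
    (O : Finset (W × W)) (f : W → ℕ) (hO : ∀ a ∈ O, f a.1 < f a.2)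
    (hin : ∀ t, (O.filter (·.2 = t)).card ≤ 2) (hout : ∀ t, (O.filter (·.1 = t)).card ≤ 2)
    (Γ : Finset (Sym2 α)) (U : Finset α) (hΓ : ∀ x, (nbrs Γ x).card ≤ 4)
    (hU : ∀ x, x ∉ U → nbrs Γ x = ∅) :
    ∑ ψ : W → α, ∏ a ∈ O, (if s(ψ a.1, ψ a.2) ∈ Γ then q else 1) ≤
      (Fintype.card α : ℝ) ^ Fintype.card W *
        (1 + 4 * U.card / Fintype.card α) ^ Fintype.card W := by
  have hn : (0 : ℝ) < Fintype.card α := by nlinarith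
  let c : α → α → ℝ := fun y x => if x ∈ nbrs Γ y then q else 1
  -- Once the head of an arc is averaged out, its effect is a factor 2, paid only if its tail lands
  -- in `U`. Arcs whose tail is gone count 1.
  let g : Finset W → (W → α) → W × W → ℝ := fun s ψ a =>
    if a.1 ∈ s then (if a.2 ∈ s then c (ψ a.1) (ψ a.2) else if ψ a.1 ∈ U then 2 else 1) else 1
  have hg0 : ∀ s ψ a, 0 ≤ g s ψ a := fun s ψ a => by
    simp only [g, c]; split_ifs <;> linarith
  suffices H : ∀ s : Finset W, ∑ ψ : W → α, ∏ a ∈ O, g s ψ a ≤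
      (Fintype.card α : ℝ) ^ Fintype.card W * (1 + 4 * U.card / Fintype.card α) ^ s.card by
    have h := H Finset.univ
    simpa [g, c, nbrs] using h
  intro s
  induction s using Finset.induction_on_max_value f with
  | empty => simp [g]
  | insert t s hts hmax ih =>
    have hstep : ∀ ψ : W → α, ∑ x, ∏ a ∈ O, g (insert t s) (Function.update ψ t x) a ≤
        (Fintype.card α + 4 * U.card : ℝ) * ∏ a ∈ O, g s ψ a := by
      intro ψ
      -- The factors unaffected by the image x of `t`. Since `t` has maximal rank, its out-arcs have
      -- heads outside `s` and carry pending factors 2, at most 2² = 4 in total; its at most two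
      -- in-arcs from `s` are handled by `sum_mul_prod_le`.
      let com : W × W → ℝ := fun a => if a.1 ∈ s ∧ a.2 ≠ t then g s ψ a else 1
      have hfac : ∀ x, ∀ a ∈ O, g (insert t s) (Function.update ψ t x) a =
          com a * ((if a.1 = t then (if x ∈ U then 2 else 1) else 1) *
            (if a.1 ∈ s ∧ a.2 = t then (if x ∈ nbrs Γ (ψ a.1) then q else 1) else 1)) := by
        rintro x ⟨j, i⟩ ha
        have hji : f j < f i := hO _ ha
        by_cases hj : j = t
        · subst hj
          have hi : i ∉ s := fun hi => absurd (hmax i hi) (by simpa using hji)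
          have hij : i ≠ j := by rintro rfl; exact lt_irrefl _ hji
          simp [g, com, hi, hij, hts]
        · by_cases hi : i = t
          · subst hi
            simp [g, com, c, hj]
          · by_cases hjs : j ∈ s <;> simp [g, com, hj, hi, hjs]
      have hfac' : ∀ a ∈ O, g s ψ a =
          com a * (if a.1 ∈ s ∧ a.2 = t then (if ψ a.1 ∈ U then 2 else 1) else 1) := by
        rintro ⟨j, i⟩ ha
        by_cases hi : i = t
        · subst hi
          simp [g, com, hts]
        · by_cases hj : j ∈ s <;> simp [g, com, hi, hj]
      have hcom : 0 ≤ ∏ a ∈ O, com a := Finset.prod_nonneg fun a _ => by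
        simp only [com]; split_ifs
        · exact hg0 _ _ _
        · exact zero_le_one
      have hout' : ∀ x, ∏ a ∈ O, (if a.1 = t then (if x ∈ U then 2 else 1) else 1 : ℝ) ≤
          if x ∈ U then 4 else 1 := by
        intro x
        rw [← Finset.prod_filter, Finset.prod_const]
        split_ifs with hx
        · calc (2 : ℝ) ^ (O.filter (·.1 = t)).card ≤ 2 ^ 2 :=
                pow_le_pow_right₀ (by norm_num) (hout t)
            _ = 4 := by norm_num
        · simp
      have hlem := sum_mul_prod_le hq hqn U (fun a : W × W => nbrs Γ (ψ a.1))
        (fun a => ψ a.1 ∈ U) (fun a => hΓ _) (fun a ha => hU _ ha)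
        (O.filter fun a => a.1 ∈ s ∧ a.2 = t)
        ((Finset.card_le_card (Finset.monotone_filter_right _ fun _ _ h => h.2)).trans (hin t))
      calc ∑ x, ∏ a ∈ O, g (insert t s) (Function.update ψ t x) a
          ≤ ∑ x, (∏ a ∈ O, com a) * ((if x ∈ U then 4 else 1) *
              ∏ a ∈ O.filter (fun a => a.1 ∈ s ∧ a.2 = t),
                (if x ∈ nbrs Γ (ψ a.1) then q else 1)) := by
            refine Finset.sum_le_sum fun x _ => ?_
            rw [Finset.prod_congr rfl (hfac x), Finset.prod_mul_distrib, Finset.prod_mul_distrib,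
              Finset.prod_filter]
            refine mul_le_mul_of_nonneg_left (mul_le_mul_of_nonneg_right (hout' x) ?_) hcom
            refine Finset.prod_nonneg fun a _ => ?_
            split_ifs <;> linarith
        _ ≤ (∏ a ∈ O, com a) * ((Fintype.card α + 4 * U.card : ℝ) *
              ∏ a ∈ O.filter (fun a => a.1 ∈ s ∧ a.2 = t), (if ψ a.1 ∈ U then 2 else 1)) := by
            rw [← Finset.mul_sum]
            exact mul_le_mul_of_nonneg_left hlem hcom
        _ = _ := by
            rw [Finset.prod_congr rfl hfac', Finset.prod_mul_distrib, Finset.prod_filter]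
            ring
    have h1 := card_mul_sum_eq_sum_update t fun ψ : W → α => ∏ a ∈ O, g (insert t s) ψ a
    have h2 : (Fintype.card α : ℝ) * ∑ ψ : W → α, ∏ a ∈ O, g (insert t s) ψ a ≤
        (Fintype.card α + 4 * U.card : ℝ) * ∑ ψ : W → α, ∏ a ∈ O, g s ψ a := by
      rw [h1, Finset.mul_sum]
      exact Finset.sum_le_sum fun ψ _ => hstep ψ
    rw [Finset.card_insert_of_notMem hts]
    refine le_of_mul_le_mul_left ?_ hn
    calc _ ≤ _ := h2
      _ ≤ (Fintype.card α + 4 * U.card : ℝ) * _ :=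
          mul_le_mul_of_nonneg_left ih (by positivity)
      _ = _ := by
          rw [pow_succ]
          field_simp

end OverlapSum

/-! ### Existence of regular graphs. -/

section Existence

/-- Take ±1, …, ±k with k = ⌊d/2⌋. If d is odd then n is even, and n/2, its own negative, is added.
-/
lemma exists_neg_mem_card_eq {n d : ℕ} [NeZero n] (hdn : d < n) (h : Even (n * d)) :
    ∃ T : Finset (ZMod n), 0 ∉ T ∧ (∀ x ∈ T, -x ∈ T) ∧ T.card = d := by
  obtain ⟨J, hJ0, hJn, hJneg, hJd⟩ : ∃ J : Finset ℕ, 0 ∉ J ∧ (∀ x ∈ J, x < n) ∧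
      (∀ x ∈ J, n - x ∈ J) ∧ J.card = d := by
    rcases Nat.even_or_odd' d with ⟨k, rfl | rfl⟩
    · refine ⟨Finset.Icc 1 k ∪ Finset.Ico (n - k) n, ?_, ?_, ?_, ?_⟩
      · simp; omega
      · simp; omega
      · simp; omega
      · rw [Finset.card_union_of_disjoint]
        · simp; omega
        · rw [Finset.disjoint_left]; simp; omega
    · have hn : Even n := by
        rcases Nat.even_mul.mp h with h | h
        · exact h
        · exact absurd h (by simp)
      obtain ⟨m, rfl⟩ := hn
      refine ⟨insert m (Finset.Icc 1 k ∪ Finset.Ico (m + m - k) (m + m)), ?_, ?_, ?_, ?_⟩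
      · simp; omega
      · intro x hx; simp at hx; omega
      · intro x hx; simp at hx ⊢; omega
      · rw [Finset.card_insert_of_notMem, Finset.card_union_of_disjoint]
        · simp; omega
        · rw [Finset.disjoint_left]; simp; omega
        · simp; omega
  refine ⟨Finset.univ.filter fun x => x.val ∈ J, by simpa using hJ0, fun x hx => ?_, ?_⟩
  · have hx' : x.val ∈ J := by simpa using hx
    have hx0 : x ≠ 0 := by rintro rfl; exact hJ0 (by simpa using hx')
    simpa [ZMod.neg_val, hx0] using hJneg _ hx'
  · rw [← hJd]
    refine Finset.card_bij' (fun x _ => x.val) (fun k _ => (k : ZMod n)) ?_ ?_ ?_ ?_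
    · simp
    · intro k hk
      simpa [ZMod.val_natCast, Nat.mod_eq_of_lt (hJn k hk)] using hk
    · simp
    · intro k hk
      simp [ZMod.val_natCast, Nat.mod_eq_of_lt (hJn k hk)]

/-- The circulant (Cayley) graph of a symmetric connection set with d elements is d-regular. -/
lemma regSets_zmod_nonempty {n d : ℕ} [NeZero n] (hdn : d < n) (h : Even (n * d)) :
    (regSets (ZMod n) d).Nonempty := by
  obtain ⟨T, hT0, hTneg, hTd⟩ := exists_neg_mem_card_eq hdn h
  let E : Finset (Sym2 (ZMod n)) :=
    (Finset.univ ×ˢ T).image fun z : ZMod n × ZMod n => s(z.1, z.1 + z.2)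
  have hE : ∀ u w, s(u, w) ∈ E ↔ w - u ∈ T := by
    intro u w
    simp only [E, Finset.mem_image, Finset.mem_product, Finset.mem_univ, true_and, Prod.exists,
      Sym2.eq_iff]
    constructor
    · rintro ⟨a, t, ht, ⟨rfl, rfl⟩ | ⟨rfl, rfl⟩⟩
      · simpa using ht
      · simpa using hTneg t ht
    · intro hT
      exact ⟨u, w - u, hT, Or.inl ⟨rfl, by ring⟩⟩
  refine ⟨E, Finset.mem_filter.mpr ⟨Finset.mem_univ _, fun e he => ?_, fun u => ?_⟩⟩
  · induction e with
    | _ a b =>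
      rw [Sym2.mk_isDiag_iff]
      rintro rfl
      exact hT0 (by simpa using (hE a a).mp he)
  · rw [← card_nbrs, ← hTd, ← Finset.card_image_of_injective T (add_right_injective u)]
    congr 1
    ext w
    simp only [nbrs, Finset.mem_filter, Finset.mem_univ, true_and, hE, Finset.mem_image]
    exact ⟨fun hw => ⟨_, hw, by ring⟩, by rintro ⟨t, ht, rfl⟩; simpa using ht⟩

/-- There is a `d`-regular graph on `n` vertices if `d < n` and `n * d` is even. -/
lemma regSets_nonempty {n d : ℕ} (hdn : d < n) (h : Even (n * d)) :
    (regSets (Fin n) d).Nonempty := by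
  cases n with
  | zero => omega
  | succ n =>
    have := regSets_zmod_nonempty hdn h
    -- `ZMod (n + 1)` is `Fin (n + 1)` by definition.
    exact this

end Existence

/-! ### From graphs to loopless edge sets. -/

open Classical in
lemma regularProb_eq (n d : ℕ) (P : SimpleGraph (Fin n) → Prop) :
    regularProb n d P =
      (((regSets (Fin n) d).filter fun E : Finset (Sym2 (Fin n)) =>
        P (SimpleGraph.fromEdgeSet (E : Set (Sym2 (Fin n))))).card
        : ℝ) / (regSets (Fin n) d).card := by
  have hdeg : ∀ E : Finset (Sym2 (Fin n)), (∀ e ∈ E, ¬ e.IsDiag) → ∀ u,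
      (SimpleGraph.fromEdgeSet (E : Set (Sym2 (Fin n)))).degree u = (E.filter (u ∈ ·)).card := by
    intro E hE u
    rw [← card_nbrs, ← SimpleGraph.card_neighborFinset_eq_degree]
    congr 1
    ext w
    simp only [SimpleGraph.mem_neighborFinset, SimpleGraph.fromEdgeSet_adj, nbrs,
      Finset.mem_filter, Finset.mem_univ, true_and, Finset.mem_coe, and_iff_left_iff_imp]
    intro h huw
    exact hE _ h (Sym2.mk_isDiag_iff.mpr huw)
  have key : ∀ Q : SimpleGraph (Fin n) → Prop, (regularGraphs n d ∩ {G | Q G}).ncard =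
      ((regSets (Fin n) d).filter fun E : Finset (Sym2 (Fin n)) =>
        Q (SimpleGraph.fromEdgeSet (E : Set (Sym2 (Fin n))))).card := by
    intro Q
    rw [← Set.ncard_coe_finset]
    symm
    refine Set.ncard_congr
      (fun (E : Finset (Sym2 (Fin n))) _ => SimpleGraph.fromEdgeSet (E : Set (Sym2 (Fin n)))) ?_ ?_ ?_
    · intro E hE
      simp only [Finset.coe_filter, Set.mem_ofPred_eq, regSets, Finset.mem_filter,
        Finset.mem_univ, true_and] at hE
      refine ⟨fun u => ?_, hE.2⟩
      rw [← hE.1.2 u]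
      convert hdeg E hE.1.1 u
    · intro E F hE hF h
      simp only [Finset.coe_filter, Set.mem_ofPred_eq, regSets, Finset.mem_filter,
        Finset.mem_univ, true_and] at hE hF
      have hd : ∀ E : Finset (Sym2 (Fin n)), (∀ e ∈ E, ¬ e.IsDiag) →
          (SimpleGraph.fromEdgeSet (E : Set (Sym2 (Fin n)))).edgeSet = E := by
        intro E hE
        rw [SimpleGraph.edgeSet_fromEdgeSet]
        ext e
        simp only [Set.mem_sdiff, Finset.mem_coe]
        exact ⟨fun h => h.1, fun h => ⟨h, hE e h⟩⟩
      have h' := congrArg SimpleGraph.edgeSet h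
      rw [hd E hE.1.1, hd F hF.1.1] at h'
      exact_mod_cast h'
    · intro G hG
      have hG' : SimpleGraph.fromEdgeSet (G.edgeFinset : Set (Sym2 (Fin n))) = G := by simp
      refine ⟨G.edgeFinset, ?_, hG'⟩
      simp only [Finset.coe_filter, Set.mem_ofPred_eq, regSets, Finset.mem_filter,
        Finset.mem_univ, true_and]
      have hnd : ∀ e ∈ G.edgeFinset, ¬ e.IsDiag := fun e he =>
        G.not_isDiag_of_mem_edgeFinset he
      refine ⟨⟨hnd, fun u => ?_⟩, by rw [hG']; exact hG.2⟩
      rw [← hdeg _ hnd u]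
      have := hG.1 u
      convert this
  rw [regularProb, key P]
  have h2 := key fun _ => True
  simp only [Set.ofPred_true, Set.inter_univ, Finset.filter_true] at h2
  rw [h2]

/-! ### Moments of the number of induced copies. -/

/-- The edges onto which the map `φ` sends the arcs of `O`. -/
def arcImage {W V : Type*} [DecidableEq V] (O : Finset (W × W)) (φ : W → V) : Finset (Sym2 V) :=
  O.image fun a => s(φ a.1, φ a.2)

/-- `O` is an acyclic orientation of the graph `K` (along the rank function `f`), with in-degrees
and out-degrees at most two. -/
structure IsTwoOrientation {W : Type*} [DecidableEq W] (K : SimpleGraph W) (O : Finset (W × W))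
    (f : W → ℕ) : Prop where
  adj : ∀ a ∈ O, K.Adj a.1 a.2
  mem : ∀ i j, K.Adj i j → (i, j) ∈ O ∨ (j, i) ∈ O
  lt : ∀ a ∈ O, f a.1 < f a.2
  in_le : ∀ t, (O.filter (·.2 = t)).card ≤ 2
  out_le : ∀ t, (O.filter (·.1 = t)).card ≤ 2

open Classical in
/-- The injective maps from `W` to `V`. -/
noncomputable def injMaps (W V : Type*) [Fintype W] [Fintype V] : Finset (W → V) :=
  Finset.univ.filter Function.Injective

/-- The map `φ` sends the edges of `K` (with orientation `O`) into `E`, and no other pairs. -/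
def IsIndCopy {W V : Type*} [DecidableEq V] (K : SimpleGraph W) (O : Finset (W × W))
    (E : Finset (Sym2 V)) (φ : W → V) : Prop :=
  arcImage O φ ⊆ E ∧ ∀ i j, i ≠ j → ¬ K.Adj i j → s(φ i, φ j) ∉ E

open Classical in
/-- The injective maps onto an induced copy of `K` (with orientation `O`) in the graph with edge
set `E`. -/
noncomputable def indCopies {W V : Type*} [Fintype W] [Fintype V] [DecidableEq V]
    (K : SimpleGraph W) (O : Finset (W × W)) (E : Finset (Sym2 V)) : Finset (W → V) :=
  (injMaps W V).filter (IsIndCopy K O E)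

section Copies

lemma mem_injMaps {W V : Type*} [Fintype W] [Fintype V] {φ : W → V} :
    φ ∈ injMaps W V ↔ Function.Injective φ := by
  simp [injMaps]

lemma card_injMaps {W V : Type*} [Fintype W] [Fintype V] :
    (injMaps W V).card = (Fintype.card V).descFactorial (Fintype.card W) := by
  classical
  rw [← Fintype.card_embedding_eq, ← Fintype.card_congr (Equiv.subtypeInjectiveEquivEmbedding W V),
    Fintype.card_subtype, injMaps]

/-- The falling factorial is at least (n - v)^v, and Bernoulli's inequality bounds (1 - v/n)^v from
below. -/
lemma le_card_injMaps {W V : Type*} [Fintype W] [Fintype V]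
    (hW : Fintype.card W ≤ Fintype.card V) (hV : 0 < Fintype.card V) :
    (Fintype.card V : ℝ) ^ Fintype.card W * (1 - (Fintype.card W : ℝ) ^ 2 / Fintype.card V) ≤
      (injMaps W V).card := by
  rw [card_injMaps]
  set n := Fintype.card V
  set v := Fintype.card W
  have hn : (0 : ℝ) < n := by exact_mod_cast hV
  have hvn : (v : ℝ) ≤ n := by exact_mod_cast hW
  have h1 : ((n - v : ℕ) ^ v : ℕ) ≤ n.descFactorial v :=
    (Nat.pow_le_pow_left (by omega) v).trans (n.pow_sub_le_descFactorial v)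
  have h2 : ((n : ℝ) - v) ^ v ≤ n.descFactorial v := by
    rw [← Nat.cast_sub hW]
    exact_mod_cast h1
  refine le_trans ?_ h2
  have h3 : 1 + (v : ℝ) * (-(v / n)) ≤ (1 + -((v : ℝ) / n)) ^ v := by
    refine one_add_mul_le_pow ?_ v
    have : (v : ℝ) / n ≤ 1 := (div_le_one hn).mpr hvn
    linarith
  calc (n : ℝ) ^ v * (1 - (v : ℝ) ^ 2 / n) = (n : ℝ) ^ v * (1 + (v : ℝ) * (-(v / n))) := by ring
    _ ≤ (n : ℝ) ^ v * (1 + -((v : ℝ) / n)) ^ v := by gcongr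
    _ = ((n : ℝ) - v) ^ v := by
      rw [← mul_pow]
      congr 1
      field_simp
      ring

lemma nbrs_arcImage_eq_empty {W V : Type*} [Fintype V] [DecidableEq V] {O : Finset (W × W)}
    (φ : W → V) {x : V} (hx : ∀ i, φ i ≠ x) :
    nbrs (arcImage O φ) x = ∅ := by
  rw [Finset.eq_empty_iff_forall_notMem]
  intro y hy
  simp only [nbrs, arcImage, Finset.mem_filter, Finset.mem_univ, true_and, Finset.mem_image,
    Sym2.eq_iff] at hy
  obtain ⟨a, _, ⟨h1, _⟩ | ⟨_, h1⟩⟩ := hy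
  · exact hx _ h1
  · exact hx _ h1

variable {W V : Type*} [DecidableEq W] {K : SimpleGraph W} {O : Finset (W × W)} {f : W → ℕ}

namespace IsTwoOrientation

lemma swap_notMem (h : IsTwoOrientation K O f) {i j : W} (hij : (i, j) ∈ O) : (j, i) ∉ O :=
  fun hji => lt_asymm (h.lt _ hij) (h.lt _ hji)

lemma card_le [Fintype W]
    (h : IsTwoOrientation K O f) : O.card ≤ 2 * Fintype.card W := by
  rw [Finset.card_eq_sum_card_fiberwise (f := Prod.snd) (t := Finset.univ) (by simp), mul_comm,
    ← smul_eq_mul, ← Finset.card_univ]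
  exact Finset.sum_le_card_nsmul _ _ _ fun t _ => h.in_le t

lemma injOn (h : IsTwoOrientation K O f) {φ : W → V} (hφ : Function.Injective φ) :
    Set.InjOn (fun a : W × W => s(φ a.1, φ a.2)) O := by
  rintro ⟨i, j⟩ hij ⟨k, l⟩ hkl he
  simp only [Sym2.eq_iff] at he
  rcases he with ⟨h1, h2⟩ | ⟨h1, h2⟩
  · rw [hφ h1, hφ h2]
  · rw [hφ h1, hφ h2] at hij
    exact absurd hij (h.swap_notMem hkl)

lemma card_arcImage [DecidableEq V]
    (h : IsTwoOrientation K O f) {φ : W → V} (hφ : Function.Injective φ) :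
    (arcImage O φ).card = O.card :=
  Finset.card_image_of_injOn (h.injOn hφ)

lemma not_isDiag [DecidableEq V]
    (h : IsTwoOrientation K O f) {φ : W → V} (hφ : Function.Injective φ) :
    ∀ e ∈ arcImage O φ, ¬ e.IsDiag := by
  intro e he
  obtain ⟨a, ha, rfl⟩ := Finset.mem_image.mp he
  rw [Sym2.mk_isDiag_iff]
  exact fun h' => (h.adj a ha).ne (hφ h')

lemma mem_arcImage [DecidableEq V]
    (h : IsTwoOrientation K O f) {φ : W → V} (hφ : Function.Injective φ) {i j : W} :
    s(φ i, φ j) ∈ arcImage O φ ↔ K.Adj i j := by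
  simp only [arcImage, Finset.mem_image, Sym2.eq_iff]
  constructor
  · rintro ⟨⟨k, l⟩, hkl, ⟨h1, h2⟩ | ⟨h1, h2⟩⟩
    · rw [← hφ h1, ← hφ h2]; exact h.adj _ hkl
    · rw [← hφ h1, ← hφ h2]; exact (h.adj _ hkl).symm
  · intro hK
    rcases h.mem i j hK with h' | h'
    · exact ⟨_, h', Or.inl ⟨rfl, rfl⟩⟩
    · exact ⟨_, h', Or.inr ⟨rfl, rfl⟩⟩

lemma card_nbrs_arcImage_le [Fintype V] [DecidableEq V]
    (h : IsTwoOrientation K O f) {φ : W → V} (hφ : Function.Injective φ)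
    (x : V) : (nbrs (arcImage O φ) x).card ≤ 4 := by
  by_cases hx : ∃ i, φ i = x
  · obtain ⟨i, rfl⟩ := hx
    have hsub : nbrs (arcImage O φ) (φ i) ⊆
        (O.filter (·.1 = i)).image (fun a => φ a.2) ∪
          (O.filter (·.2 = i)).image (fun a => φ a.1) := by
      intro y hy
      simp only [nbrs, arcImage, Finset.mem_filter, Finset.mem_univ, true_and, Finset.mem_image,
        Sym2.eq_iff, Finset.mem_union] at hy ⊢
      obtain ⟨a, ha, ⟨h1, h2⟩ | ⟨h1, h2⟩⟩ := hy
      · exact Or.inl ⟨a, ⟨ha, hφ h1⟩, h2⟩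
      · exact Or.inr ⟨a, ⟨ha, hφ h2⟩, h1⟩
    refine (Finset.card_le_card hsub).trans ((Finset.card_union_le _ _).trans ?_)
    have h1 := Finset.card_image_le (s := O.filter (·.1 = i)) (f := fun a => φ a.2)
    have h2 := Finset.card_image_le (s := O.filter (·.2 = i)) (f := fun a => φ a.1)
    have := h.in_le i
    have := h.out_le i
    omega
  · rw [nbrs_arcImage_eq_empty φ (by simpa using hx)]
    simp

end IsTwoOrientation

/-- The expected number of induced copies, from below. -/
lemma le_sum_card_indCopies [Fintype W] [Fintype V] [DecidableEq V]
    (h : IsTwoOrientation K O f) {d : ℕ} {ε : ℝ} (hd : 5 ≤ d)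
    (hV : 0 < Fintype.card V) (hdV : d ≤ Fintype.card V) (hε : ε < 1)
    (hm : (9 / d + d / Fintype.card V : ℝ) +
      (2 * (d * (d + 1)) + 2 * (2 * O.card + 1 : ℕ) : ℝ) / (Fintype.card V * d) ≤ ε) :
    ((injMaps W V).card * (regSets V d).card : ℝ) *
      (((d / Fintype.card V : ℝ) * (1 - ε)) ^ O.card - (Fintype.card W : ℝ) ^ 2 *
        ((d / Fintype.card V : ℝ) / (1 - ε)) ^ (O.card + 1)) ≤
      ∑ E ∈ regSets V d, ((indCopies K O E).card : ℝ) := by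
  classical
  have hd0 : (0 : ℝ) < d := by exact_mod_cast (by omega : 0 < d)
  have hV0 : (0 : ℝ) < Fintype.card V := by exact_mod_cast hV
  have hm' : (2 * (d * (d + 1)) + 2 * (2 * O.card + 1 : ℕ) : ℝ) ≤
      ε * (Fintype.card V * d) := by
    rw [← div_le_iff₀ (by positivity)]
    have : (0 : ℝ) ≤ 9 / d + d / Fintype.card V := by positivity
    linarith
  have hswap : ∑ E ∈ regSets V d, ((indCopies K O E).card : ℝ) =
      ∑ φ ∈ injMaps W V, (((regSets V d).filter fun E => IsIndCopy K O E φ).card : ℝ) := by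
    have := Finset.sum_card_bipartiteAbove_eq_sum_card_bipartiteBelow
      (s := regSets V d) (t := injMaps W V) (IsIndCopy K O)
    rw [← Nat.cast_sum, ← Nat.cast_sum]
    exact congrArg Nat.cast this
  rw [hswap, mul_assoc, ← nsmul_eq_mul]
  refine Finset.card_nsmul_le_sum _ _ _ fun φ hφ => ?_
  rw [mem_injMaps] at hφ
  -- Union bound: a non-induced copy contains the e image edges and one more, at an extra factor of
  -- about p. There are at most v² ordered pairs to blame.
  set Bad : Finset (W × W) := Finset.univ.filter fun z => z.1 ≠ z.2 ∧ ¬ K.Adj z.1 z.2 with hBad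
  have hsub : regExt d (arcImage O φ) ⊆ ((regSets V d).filter fun E => IsIndCopy K O E φ) ∪
      Bad.biUnion fun z => regExt d (insert s(φ z.1, φ z.2) (arcImage O φ)) := by
    intro E hE
    rw [mem_regExt] at hE
    by_cases hgood : ∀ i j, i ≠ j → ¬ K.Adj i j → s(φ i, φ j) ∉ E
    · exact Finset.mem_union_left _ (Finset.mem_filter.mpr ⟨hE.1, hE.2, hgood⟩)
    · push Not at hgood
      obtain ⟨i, j, hij, hK, hmem⟩ := hgood
      refine Finset.mem_union_right _ (Finset.mem_biUnion.mpr ⟨(i, j), by simp [Bad, hij, hK], ?_⟩)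
      exact mem_regExt.mpr ⟨hE.1, Finset.insert_subset hmem hE.2⟩
  have hcard := (Finset.card_le_card hsub).trans (Finset.card_union_le _ _)
  have hlow := le_card_regExt hd hV hdV hε.le hm (arcImage O φ)
    (by rw [h.card_arcImage hφ]; omega) (h.not_isDiag hφ) (h.card_nbrs_arcImage_le hφ)
  rw [h.card_arcImage hφ] at hlow
  have hbad : ((Bad.biUnion fun z =>
      regExt d (insert s(φ z.1, φ z.2) (arcImage O φ))).card : ℝ) ≤
      (Fintype.card W : ℝ) ^ 2 * (((d / Fintype.card V : ℝ) / (1 - ε)) ^ (O.card + 1) *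
        (regSets V d).card) := by
    have h1 : ((Bad.biUnion fun z =>
        regExt d (insert s(φ z.1, φ z.2) (arcImage O φ))).card : ℝ) ≤
        ∑ z ∈ Bad, ((regExt d (insert s(φ z.1, φ z.2) (arcImage O φ))).card : ℝ) := by
      exact_mod_cast Finset.card_biUnion_le
    have h2 : ∀ z ∈ Bad, ((regExt d (insert s(φ z.1, φ z.2) (arcImage O φ))).card : ℝ) ≤
        ((d / Fintype.card V : ℝ) / (1 - ε)) ^ (O.card + 1) * (regSets V d).card := by
      intro z hz
      have hz' := (Finset.mem_filter.mp hz).2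
      have hnot : s(φ z.1, φ z.2) ∉ arcImage O φ := fun h' => hz'.2 ((h.mem_arcImage hφ).mp h')
      have hc : (insert s(φ z.1, φ z.2) (arcImage O φ)).card = O.card + 1 := by
        rw [Finset.card_insert_of_notMem hnot, h.card_arcImage hφ]
      have := card_regExt_le (by omega) hV hε hm' (insert s(φ z.1, φ z.2) (arcImage O φ))
        (by rw [hc]; omega)
      rwa [hc] at this
    have h3 : (Bad.card : ℝ) ≤ (Fintype.card W : ℝ) ^ 2 := by
      have := Finset.card_le_univ Bad
      rw [Fintype.card_prod, ← sq] at this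
      exact_mod_cast this
    have hε' : 0 < 1 - ε := by linarith
    calc _ ≤ _ := h1
      _ ≤ _ := Finset.sum_le_card_nsmul _ _ _ h2
      _ ≤ _ := by
        rw [nsmul_eq_mul]
        exact mul_le_mul_of_nonneg_right h3 (by positivity)
  have hcard' : ((regExt d (arcImage O φ)).card : ℝ) ≤
      (((regSets V d).filter fun E => IsIndCopy K O E φ).card : ℝ) +
      ((Bad.biUnion fun z => regExt d (insert s(φ z.1, φ z.2) (arcImage O φ))).card : ℝ) := by
    exact_mod_cast hcard
  linarith

/-- The second moment of the number of induced copies, from above. -/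
lemma sum_card_indCopies_sq_le [Fintype W] [Fintype V] [DecidableEq V]
    (h : IsTwoOrientation K O f) {d : ℕ} {ε : ℝ} (hd : 0 < d)
    (hV : 0 < Fintype.card V) (hdV : d ≤ Fintype.card V) (hε0 : 0 ≤ ε) (hε : ε < 1)
    (hm : (2 * (d * (d + 1)) + 2 * (2 * O.card + 1 : ℕ) : ℝ) ≤ ε * (Fintype.card V * d))
    (hq : 16 * ((Fintype.card V : ℝ) / d) ^ 2 ≤ Fintype.card V) :
    ∑ E ∈ regSets V d, ((indCopies K O E).card : ℝ) ^ 2 ≤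
      (injMaps W V).card * (regSets V d).card *
        ((d / Fintype.card V : ℝ) / (1 - ε)) ^ (2 * O.card) *
        ((Fintype.card V : ℝ) ^ Fintype.card W *
          (1 + 4 * Fintype.card W / Fintype.card V) ^ Fintype.card W) := by
  classical
  have hd0 : (0 : ℝ) < d := by exact_mod_cast hd
  have hV0 : (0 : ℝ) < Fintype.card V := by exact_mod_cast hV
  have hdV' : (d : ℝ) ≤ Fintype.card V := by exact_mod_cast hdV
  have hε' : 0 < 1 - ε := by linarith
  have hq1 : (1 : ℝ) ≤ Fintype.card V / d := (one_le_div hd0).mpr hdV'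
  have hX : ∑ E ∈ regSets V d, ((indCopies K O E).card : ℝ) ^ 2 ≤
      ∑ φ ∈ injMaps W V, ∑ ψ ∈ injMaps W V,
        ((regExt d (arcImage O φ ∪ arcImage O ψ)).card : ℝ) := by
    have h1 : ∀ E ∈ regSets V d, (indCopies K O E).card ^ 2 ≤
        ((injMaps W V ×ˢ injMaps W V).filter fun z =>
          arcImage O z.1 ∪ arcImage O z.2 ⊆ E).card := by
      intro E _
      rw [sq, ← Finset.card_product]
      refine Finset.card_le_card fun z hz => ?_
      simp only [indCopies, Finset.mem_product, Finset.mem_filter] at hz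
      simp only [Finset.mem_product, Finset.mem_filter]
      exact ⟨⟨hz.1.1, hz.2.1⟩, Finset.union_subset hz.1.2.1 hz.2.2.1⟩
    have h2 := Finset.sum_card_bipartiteAbove_eq_sum_card_bipartiteBelow
      (s := regSets V d) (t := injMaps W V ×ˢ injMaps W V)
      (fun E z => arcImage O z.1 ∪ arcImage O z.2 ⊆ E)
    have h3 := (Finset.sum_le_sum h1).trans h2.le
    rw [Finset.sum_product] at h3
    exact_mod_cast h3
  refine hX.trans ?_
  rw [mul_assoc, mul_assoc, ← nsmul_eq_mul]
  refine Finset.sum_le_card_nsmul _ _ _ fun φ hφ => ?_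
  rw [mem_injMaps] at hφ
  set p : ℝ := (d / Fintype.card V : ℝ) with hp
  set q : ℝ := (Fintype.card V : ℝ) / d with hqdef
  have hpq : p * q = 1 := by rw [hp, hqdef]; field_simp
  have hp0 : 0 < p := by positivity
  have hterm : ∀ ψ ∈ injMaps W V, ((regExt d (arcImage O φ ∪ arcImage O ψ)).card : ℝ) ≤
      (regSets V d).card * (p / (1 - ε)) ^ (2 * O.card) *
        ∏ a ∈ O, (if s(ψ a.1, ψ a.2) ∈ arcImage O φ then q else 1) := by
    intro ψ hψ
    rw [mem_injMaps] at hψ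
    have hun := Finset.card_union_add_card_inter (arcImage O φ) (arcImage O ψ)
    rw [h.card_arcImage hφ, h.card_arcImage hψ] at hun
    set U := arcImage O φ ∪ arcImage O ψ with hU
    set k := (arcImage O φ ∩ arcImage O ψ).card with hk
    have hkr : k ≤ (O.filter fun a => s(ψ a.1, ψ a.2) ∈ arcImage O φ).card := by
      refine (Finset.card_le_card fun e he => ?_).trans
        (Finset.card_image_le (f := fun a : W × W => s(ψ a.1, ψ a.2)))
      rw [Finset.mem_inter] at he
      obtain ⟨a, ha, rfl⟩ := Finset.mem_image.mp he.2
      exact Finset.mem_image.mpr ⟨a, Finset.mem_filter.mpr ⟨ha, he.1⟩, rfl⟩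
    have hreg := card_regExt_le hd hV hε hm U (by omega)
    have hu1 : 1 ≤ 1 / (1 - ε) := by rw [le_div_iff₀ hε']; linarith
    have hpow : (p / (1 - ε)) ^ U.card ≤ (p / (1 - ε)) ^ (2 * O.card) *
        ∏ a ∈ O, (if s(ψ a.1, ψ a.2) ∈ arcImage O φ then q else 1) := by
      rw [← Finset.prod_filter, Finset.prod_const]
      -- The union has 2e - k edges, and inserting (pq)^k = 1 turns p^(2e-k) into p^(2e) q^k.
      have h2e : 2 * O.card = U.card + k := by omega
      calc (p / (1 - ε)) ^ U.card = p ^ U.card * (1 / (1 - ε)) ^ U.card * (p * q) ^ k := by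
            rw [hpq, one_pow, mul_one, ← mul_pow, mul_one_div]
        _ = p ^ (2 * O.card) * q ^ k * (1 / (1 - ε)) ^ U.card := by
            rw [h2e, mul_pow, pow_add]; ring
        _ ≤ p ^ (2 * O.card) *
            q ^ (O.filter fun a => s(ψ a.1, ψ a.2) ∈ arcImage O φ).card *
              (1 / (1 - ε)) ^ (2 * O.card) := by
            gcongr
            omega
        _ = _ := by
            rw [← mul_one_div p, mul_pow]; ring
    refine hreg.trans ?_
    rw [mul_comm, mul_assoc]
    exact mul_le_mul_of_nonneg_left hpow (by positivity)
  refine (Finset.sum_le_sum hterm).trans ?_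
  rw [← Finset.mul_sum, mul_assoc]
  refine mul_le_mul_of_nonneg_left (mul_le_mul_of_nonneg_left ?_ (by positivity)) (by positivity)
  have harcs := sum_prod_arcs_le hq1 hq O f h.lt h.in_le h.out_le (arcImage O φ)
    (Finset.univ.image φ) (h.card_nbrs_arcImage_le hφ)
    (fun x hx => nbrs_arcImage_eq_empty φ (by simpa using hx))
  rw [Finset.card_image_of_injective _ hφ, Finset.card_univ] at harcs
  -- Dropping injectivity of ψ only enlarges the sum and makes the coordinates of ψ independent.
  refine le_trans (Finset.sum_le_sum_of_subset_of_nonneg (Finset.subset_univ _) ?_) harcs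
  intro ψ _ _
  refine Finset.prod_nonneg fun a _ => ?_
  split_ifs <;> linarith

end Copies

/-! ### The second moment inequality. -/

/-- A lower bound for the probability that a random regular graph has an induced copy of `K`. -/
lemma le_regularProb {W : Type*} [Fintype W] [DecidableEq W] {K : SimpleGraph W}
    {O : Finset (W × W)} {f : W → ℕ} (h : IsTwoOrientation K O f) {n d : ℕ} {ε y : ℝ}
    (hd : 5 ≤ d) (hdn : d < n) (heven : Even (n * d)) (hWn : Fintype.card W ≤ n)
    (hε0 : 0 ≤ ε) (hε : ε < 1)
    (hm : (9 / d + d / n : ℝ) +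
      (2 * (d * (d + 1)) + 2 * (2 * O.card + 1 : ℕ) : ℝ) / (n * d) ≤ ε)
    (hq : 16 * ((n : ℝ) / d) ^ 2 ≤ n) (hy : y = (1 - ε) ^ (O.card + 1))
    (hB : 0 ≤ y - (Fintype.card W : ℝ) ^ 2 * (d / n) / y) :
    (1 - (Fintype.card W : ℝ) ^ 2 / n) *
        (y - (Fintype.card W : ℝ) ^ 2 * (d / n) / y) ^ 2 * y ^ 2 /
        (1 + 4 * Fintype.card W / n) ^ Fintype.card W ≤
      regularProb n d (fun G => K.IsIndContained G) := by
  classical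
  have hn : 0 < n := by omega
  have hn0 : (0 : ℝ) < n := by exact_mod_cast hn
  have hd0 : (0 : ℝ) < d := by exact_mod_cast (by omega : 0 < d)
  have hε' : 0 < 1 - ε := by linarith
  have hε1 : 1 - ε ≤ 1 := by linarith
  have hy0 : 0 < y := by rw [hy]; positivity
  have hm' : (2 * (d * (d + 1)) + 2 * (2 * O.card + 1 : ℕ) : ℝ) ≤ ε * (n * d) := by
    rw [← div_le_iff₀ (by positivity)]
    have : (0 : ℝ) ≤ 9 / d + d / n := by positivity
    linarith
  have hS1 := le_sum_card_indCopies (V := Fin n) h hd (by simp [hn])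
    (by simpa using hdn.le) hε (by simpa using hm)
  have hS2 := sum_card_indCopies_sq_le (V := Fin n) (d := d) h (by omega) (by simp [hn])
    (by simpa using hdn.le) hε0 hε (by simpa using hm') (by simpa using hq)
  have hN := le_card_injMaps (W := W) (V := Fin n) (by simpa using hWn) (by simpa using hn)
  have hNpos : 0 < (injMaps W (Fin n)).card := by
    rw [card_injMaps]
    exact Nat.pos_of_ne_zero fun h0 => by
      rw [Nat.descFactorial_eq_zero_iff_lt, Fintype.card_fin] at h0
      omega
  have hDpos : 0 < (regSets (Fin n) d).card := (regSets_nonempty hdn heven).card_pos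
  rw [regularProb_eq]
  set good := (regSets (Fin n) d).filter fun E : Finset (Sym2 (Fin n)) =>
    K.IsIndContained (SimpleGraph.fromEdgeSet (E : Set (Sym2 (Fin n)))) with hgood
  have hgoodE : ∀ E ∈ regSets (Fin n) d, E ∉ good → (indCopies K O E).card = 0 := by
    intro E hE hEg
    rw [Finset.card_eq_zero, Finset.eq_empty_iff_forall_notMem]
    intro φ hφ
    simp only [indCopies, Finset.mem_filter, mem_injMaps] at hφ
    obtain ⟨hinj, hsub, hind⟩ := hφ
    refine hEg (Finset.mem_filter.mpr ⟨hE, ⟨⟨⟨φ, hinj⟩, ?_⟩⟩⟩)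
    intro i j
    simp only [Function.Embedding.coeFn_mk, SimpleGraph.fromEdgeSet_adj, Finset.mem_coe]
    constructor
    · rintro ⟨h1, h2⟩
      by_contra hK
      exact hind i j (fun hij => h2 (congrArg φ hij)) hK h1
    · intro hK
      exact ⟨hsub ((h.mem_arcImage hinj).mpr hK), fun hij => hK.ne (hinj hij)⟩
  have hsum1 : ∑ E ∈ regSets (Fin n) d, ((indCopies K O E).card : ℝ) =
      ∑ E ∈ good, ((indCopies K O E).card : ℝ) := by
    refine (Finset.sum_subset (Finset.filter_subset _ _) fun E hE hEg => ?_).symm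
    rw [hgoodE E hE hEg, Nat.cast_zero]
  have hsum2 : ∑ E ∈ good, ((indCopies K O E).card : ℝ) ^ 2 ≤
      ∑ E ∈ regSets (Fin n) d, ((indCopies K O E).card : ℝ) ^ 2 :=
    Finset.sum_le_sum_of_subset_of_nonneg (Finset.filter_subset _ _)
      fun _ _ _ => sq_nonneg _
  -- Cauchy–Schwarz on the graphs that have a copy; all others contribute nothing to the first
  -- moment.
  have hCS : (∑ E ∈ good, ((indCopies K O E).card : ℝ)) ^ 2 ≤
      good.card * ∑ E ∈ good, ((indCopies K O E).card : ℝ) ^ 2 :=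
    sq_sum_le_card_mul_sum_sq
  simp only [Fintype.card_fin] at hS1 hS2 hN
  rw [hsum1] at hS1
  have hS2 := hsum2.trans hS2
  generalize ∑ E ∈ good, ((indCopies K O E).card : ℝ) = S₁ at *
  generalize ∑ E ∈ good, ((indCopies K O E).card : ℝ) ^ 2 = S₂ at *
  have hNpos' : (0 : ℝ) < (injMaps W (Fin n)).card := by exact_mod_cast hNpos
  have hDpos' : (0 : ℝ) < (regSets (Fin n) d).card := by exact_mod_cast hDpos
  have hc0 : (0 : ℝ) ≤ good.card := by positivity
  generalize ((injMaps W (Fin n)).card : ℝ) = N at *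
  generalize ((regSets (Fin n) d).card : ℝ) = D at *
  generalize (good.card : ℝ) = c at *
  have hp0 : (0 : ℝ) < d / n := by positivity
  generalize (d / n : ℝ) = p at *
  have hNv : (0 : ℝ) < (n : ℝ) ^ Fintype.card W := by positivity
  have hT : (0 : ℝ) < (1 + 4 * Fintype.card W / n : ℝ) ^ Fintype.card W := by positivity
  generalize (1 + 4 * Fintype.card W / n : ℝ) ^ Fintype.card W = T at *
  generalize (n : ℝ) ^ Fintype.card W = Nv at *
  set e := O.card
  set v : ℝ := (Fintype.card W : ℝ)
  set B := y - v ^ 2 * p / y with hBdef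
  -- The single quantity `y` absorbs every power of 1 - ε, with exponent e + 1 for the copies with
  -- one additional edge.
  have hye : y ≤ (1 - ε) ^ e := by
    rw [hy]
    exact pow_le_pow_of_le_one hε'.le hε1 (by omega)
  have hA : p ^ e * B ≤ (p * (1 - ε)) ^ e - v ^ 2 * (p / (1 - ε)) ^ (e + 1) := by
    rw [hBdef, mul_pow, div_pow, ← hy, mul_sub]
    have h1 : p ^ e * y ≤ p ^ e * (1 - ε) ^ e := by gcongr
    have h2 : p ^ e * (v ^ 2 * p / y) = v ^ 2 * (p ^ (e + 1) / y) := by rw [pow_succ]; ring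
    linarith
  have hS1' : N * D * (p ^ e * B) ≤ S₁ := (mul_le_mul_of_nonneg_left hA (by positivity)).trans hS1
  have hS2' : S₂ * y ^ 2 ≤ N * D * p ^ (2 * e) * (Nv * T) := by
    have h1 : (p / (1 - ε)) ^ (2 * e) * y ^ 2 ≤ p ^ (2 * e) := by
      rw [div_pow, div_mul_eq_mul_div, div_le_iff₀ (by positivity)]
      gcongr
      rw [mul_comm 2 e, pow_mul]
      gcongr
    calc S₂ * y ^ 2 ≤ N * D * (p / (1 - ε)) ^ (2 * e) * (Nv * T) * y ^ 2 := by gcongr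
      _ = N * D * ((p / (1 - ε)) ^ (2 * e) * y ^ 2) * (Nv * T) := by ring
      _ ≤ N * D * p ^ (2 * e) * (Nv * T) := by gcongr
  have hmain : (N * D * (p ^ e * B)) ^ 2 * y ^ 2 ≤ c * (N * D * p ^ (2 * e) * (Nv * T)) := by
    calc (N * D * (p ^ e * B)) ^ 2 * y ^ 2 ≤ S₁ ^ 2 * y ^ 2 := by gcongr
      _ ≤ c * S₂ * y ^ 2 := by gcongr
      _ = c * (S₂ * y ^ 2) := by ring
      _ ≤ _ := by gcongr
  have hmain' : N * D * B ^ 2 * y ^ 2 ≤ c * (Nv * T) := by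
    refine le_of_mul_le_mul_left ?_ (by positivity : 0 < N * D * p ^ (2 * e))
    calc N * D * p ^ (2 * e) * (N * D * B ^ 2 * y ^ 2)
        = (N * D * (p ^ e * B)) ^ 2 * y ^ 2 := by rw [mul_comm 2 e, pow_mul]; ring
      _ ≤ _ := hmain
      _ = _ := by ring
  rw [div_le_div_iff₀ hT hDpos']
  refine le_of_mul_le_mul_left ?_ hNv
  calc Nv * ((1 - v ^ 2 / n) * B ^ 2 * y ^ 2 * D)
      = Nv * (1 - v ^ 2 / n) * (D * B ^ 2 * y ^ 2) := by ring
    _ ≤ N * (D * B ^ 2 * y ^ 2) := by gcongr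
    _ = N * D * B ^ 2 * y ^ 2 := by ring
    _ ≤ c * (Nv * T) := hmain'
    _ = Nv * (c * T) := by ring

/-! ### The grid as an acyclic two-orientation. -/

/-- The arcs of the square grid, directed rightwards and upwards. -/
def gridArcs (L : ℕ) : Finset ((Fin L × Fin L) × (Fin L × Fin L)) :=
  Finset.univ.filter fun a => (a.1.1.val + 1 = a.2.1.val ∧ a.1.2 = a.2.2) ∨
    (a.1.2.val + 1 = a.2.2.val ∧ a.1.1 = a.2.1)

lemma isTwoOrientation_gridArcs (L : ℕ) :
    IsTwoOrientation (squareGrid L) (gridArcs L) (fun x => x.1.val + x.2.val) where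
  adj := by
    rintro ⟨⟨i, j⟩, k, l⟩ ha
    simp only [gridArcs, Finset.mem_filter, Finset.mem_univ, true_and] at ha
    simp only [squareGrid, SimpleGraph.boxProd_adj, SimpleGraph.pathGraph_adj]
    tauto
  mem := by
    rintro ⟨i, j⟩ ⟨k, l⟩ h
    simp only [squareGrid, SimpleGraph.boxProd_adj, SimpleGraph.pathGraph_adj] at h
    simp only [gridArcs, Finset.mem_filter, Finset.mem_univ, true_and]
    rcases h with ⟨h | h, h'⟩ | ⟨h | h, h'⟩ <;> simp [h, h']
  lt := by
    rintro ⟨⟨i, j⟩, k, l⟩ ha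
    simp only [gridArcs, Finset.mem_filter, Finset.mem_univ, true_and, Fin.ext_iff] at ha
    simp only
    omega
  in_le := by
    intro t
    -- Given its head, an arc is determined by its axis, which the Boolean records.
    refine Finset.card_le_card_of_injOn (t := (Finset.univ : Finset Bool))
      (fun a => decide (a.1.1 = a.2.1)) (fun _ _ => Finset.mem_coe.mpr (Finset.mem_univ _)) ?_
    rintro ⟨⟨i, j⟩, k, l⟩ ha ⟨⟨i', j'⟩, k', l'⟩ ha' h
    simp only [gridArcs, Finset.coe_filter, Finset.mem_filter, Finset.mem_univ, true_and,
      Set.mem_ofPred_eq] at ha ha'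
    obtain ⟨ha, rfl⟩ := ha
    obtain ⟨ha', h'⟩ := ha'
    simp only [Prod.mk.injEq, decide_eq_decide, Fin.ext_iff] at h h' ha ha' ⊢
    omega
  out_le := by
    intro t
    refine Finset.card_le_card_of_injOn (t := (Finset.univ : Finset Bool))
      (fun a => decide (a.1.1 = a.2.1)) (fun _ _ => Finset.mem_coe.mpr (Finset.mem_univ _)) ?_
    rintro ⟨⟨i, j⟩, k, l⟩ ha ⟨⟨i', j'⟩, k', l'⟩ ha' h
    simp only [gridArcs, Finset.coe_filter, Finset.mem_filter, Finset.mem_univ, true_and,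
      Set.mem_ofPred_eq] at ha ha'
    obtain ⟨ha, rfl⟩ := ha
    obtain ⟨ha', h'⟩ := ha'
    simp only [Prod.mk.injEq, decide_eq_decide, Fin.ext_iff] at h h' ha ha' ⊢
    omega

/-! ### Asymptotics and conclusion. -/

lemma isLittleO_natCast_rpow {a b : ℝ} (hab : a < b) :
    (fun n : ℕ => (n : ℝ) ^ a) =o[atTop] fun n : ℕ => (n : ℝ) ^ b := by
  refine (isLittleO_iff_tendsto' ?_).mpr ?_
  · filter_upwards [eventually_gt_atTop 0] with n hn h0
    have : (0 : ℝ) < n := by exact_mod_cast hn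
    exact absurd h0 (by positivity)
  · have h := (tendsto_rpow_neg_atTop (sub_pos.mpr hab)).comp tendsto_natCast_atTop_atTop
    refine h.congr' ?_
    filter_upwards [eventually_gt_atTop 0] with n hn
    have : (0 : ℝ) < n := by exact_mod_cast hn
    simp only [Function.comp, neg_sub, Real.rpow_sub this]

lemma isBigO_natCast_rpow {a b : ℝ} (hab : a ≤ b) :
    (fun n : ℕ => (n : ℝ) ^ a) =O[atTop] fun n : ℕ => (n : ℝ) ^ b := by
  rcases hab.eq_or_lt with rfl | h
  · exact isBigO_refl _ _
  · exact (isLittleO_natCast_rpow h).isBigO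

lemma regularProb_le_one (n d : ℕ) (P : SimpleGraph (Fin n) → Prop) : regularProb n d P ≤ 1 := by
  refine div_le_one_of_le₀ ?_ (Nat.cast_nonneg _)
  exact_mod_cast Set.ncard_le_ncard Set.inter_subset_left (Set.toFinite _)

theorem mainTheorem3 (c : ℝ) (hc₁ : 1 / 2 < c) (hc₂ : c < 1)
    (d : ℕ → ℕ) (hd : (fun n : ℕ => (d n : ℝ)) =Θ[atTop] (fun n : ℕ => (n : ℝ) ^ c))
    (L : ℕ → ℕ)
    (hL : (fun n : ℕ => ((L n ^ 2 : ℕ) : ℝ)) =o[atTop]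
      (fun n : ℕ => (n : ℝ) ^ (min ((1 - c) / 2) (c / 3)))) :
    Tendsto (fun n : ℕ => regularProb n (d n) (fun G => (squareGrid (L n)).IsIndContained G))
      (atTop ⊓ 𝓟 {n : ℕ | Even (n * d n)}) (𝓝 1) := by
  set v : ℕ → ℝ := fun n => ((L n ^ 2 : ℕ) : ℝ) with hv
  set k : ℝ := min ((1 - c) / 2) (c / 3) with hk
  have hk1 : k ≤ (1 - c) / 2 := min_le_left _ _
  have hk2 : k ≤ c / 3 := min_le_right _ _
  have hn1 : (fun n : ℕ => (n : ℝ) ^ (1 : ℝ)) = fun n : ℕ => (n : ℝ) := by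
    funext n; exact Real.rpow_one _
  have hadd : ∀ a b : ℝ, (fun n : ℕ => (n : ℝ) ^ a * (n : ℝ) ^ b) =ᶠ[atTop]
      fun n : ℕ => (n : ℝ) ^ (a + b) := fun a b => by
    filter_upwards [eventually_gt_atTop 0] with n hn
    have : (0 : ℝ) < n := by exact_mod_cast hn
    exact (Real.rpow_add this a b).symm
  have hdn : (fun n => (d n : ℝ)) =o[atTop] fun n : ℕ => (n : ℝ) := by
    rw [← hn1]; exact hd.trans_isLittleO (isLittleO_natCast_rpow hc₂)
  have h1d : (fun _ : ℕ => (1 : ℝ)) =o[atTop] fun n => (d n : ℝ) := by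
    have := isLittleO_natCast_rpow (a := 0) (b := c) (by linarith)
    simp only [Real.rpow_zero] at this
    exact this.trans_isTheta hd.symm
  have hvd : v =o[atTop] fun n => (d n : ℝ) :=
    (hL.trans_isBigO (isBigO_natCast_rpow (by linarith : k ≤ c))).trans_isTheta hd.symm
  have hvv : (fun n => v n ^ 2) =o[atTop] fun n : ℕ => (n : ℝ) ^ (1 - c) := by
    have h1 : (fun n => v n * v n) =o[atTop] fun n : ℕ => (n : ℝ) ^ k * (n : ℝ) ^ k := hL.mul hL
    have h2 := (h1.trans_eventuallyEq (hadd k k)).trans_isBigO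
      (isBigO_natCast_rpow (by linarith : k + k ≤ 1 - c))
    simpa only [sq] using h2
  have hvn : (fun n => v n ^ 2) =o[atTop] fun n : ℕ => (n : ℝ) := by
    rw [← hn1]
    exact hvv.trans_isBigO (isBigO_natCast_rpow (by linarith))
  -- This is v²p → 0, which makes unwanted edges inside a copy negligible; it rests on k ≤ (1 -
  -- c)/2.
  have hvvd : (fun n => v n ^ 2 * d n) =o[atTop] fun n : ℕ => (n : ℝ) := by
    rw [← hn1]
    have h1 := (hvv.mul_isBigO hd.isBigO).trans_eventuallyEq (hadd (1 - c) c)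
    simpa using h1
  -- Here c > 1/2 is used; it yields 16(n/d)² ≤ n for the overlap sum.
  have hnd : (fun n : ℕ => (n : ℝ)) =o[atTop] fun n => (d n : ℝ) * d n := by
    have h1 := (isLittleO_natCast_rpow (by linarith : 1 < c + c)).trans_eventuallyEq
      (hadd c c).symm
    rw [hn1] at h1
    exact h1.trans_isTheta (hd.symm.mul hd.symm)
  have t1 := hdn.tendsto_div_nhds_zero
  have t2 := h1d.tendsto_div_nhds_zero
  have t3 := hvd.tendsto_div_nhds_zero
  have t4 := hvn.tendsto_div_nhds_zero
  have t5 := hvvd.tendsto_div_nhds_zero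
  have t6 := hnd.tendsto_div_nhds_zero
  have hvle : ∀ n, v n ≤ v n ^ 2 := fun n => by
    simp only [hv]
    exact_mod_cast Nat.le_self_pow two_ne_zero _
  have hv0 : ∀ n, 0 ≤ v n := fun n => Nat.cast_nonneg _
  have t7 : Tendsto (fun n => v n * d n / n) atTop (𝓝 0) :=
    squeeze_zero (fun n => div_nonneg (mul_nonneg (hv0 n) (Nat.cast_nonneg _)) (Nat.cast_nonneg _))
      (fun n => div_le_div_of_nonneg_right
        (mul_le_mul_of_nonneg_right (hvle n) (Nat.cast_nonneg _)) (Nat.cast_nonneg _)) t5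
  -- The switching error is 9/d + d/n plus (2d² + 2d + 4e + 2)/(nd). As d ≤ n and e ≤ 2v ≤ 2n, the
  -- latter is at most 2d/n + 12/d.
  set ε : ℕ → ℝ := fun n => 21 * (1 / d n) + 3 * (d n / n) with hεdef
  have hε0 : ∀ n, 0 ≤ ε n := fun n => by simp only [hεdef]; positivity
  have hεt : Tendsto ε atTop (𝓝 0) := by
    have h1 := (t2.const_mul 21).add (t1.const_mul 3)
    simp only [mul_zero, add_zero] at h1
    exact h1
  have hvε : Tendsto (fun n => (2 * v n + 1) * ε n) atTop (𝓝 0) := by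
    have h1 := (((t3.const_mul 42).add (t7.const_mul 6)).add hεt)
    simp only [mul_zero, add_zero] at h1
    refine h1.congr fun n => ?_
    simp only [hεdef]
    ring
  set e : ℕ → ℕ := fun n => (gridArcs (L n)).card with he
  have hcardW : ∀ n, Fintype.card (Fin (L n) × Fin (L n)) = L n ^ 2 := fun n => by
    simp [sq]
  have hev : ∀ n, (e n : ℝ) ≤ 2 * v n := fun n => by
    have := (isTwoOrientation_gridArcs (L n)).card_le
    rw [hcardW] at this
    simp only [hv, he]
    exact_mod_cast this
  set y : ℕ → ℝ := fun n => (1 - ε n) ^ (e n + 1) with hy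
  have hεlt : ∀ᶠ n in atTop, ε n < 1 := hεt.eventually (gt_mem_nhds one_pos)
  have hyt : Tendsto y atTop (𝓝 1) := by
    have hlow : Tendsto (fun n => 1 - (2 * v n + 1) * ε n) atTop (𝓝 1) := by
      simpa using hvε.const_sub 1
    refine tendsto_of_tendsto_of_tendsto_of_le_of_le' hlow tendsto_const_nhds ?_ ?_
    · filter_upwards [hεlt] with n hn
      have h1 := one_add_mul_le_pow (a := -ε n) (by linarith) (e n + 1)
      push_cast at h1
      have h2 : ((e n : ℝ) + 1) * ε n ≤ (2 * v n + 1) * ε n :=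
        mul_le_mul_of_nonneg_right (by linarith [hev n]) (hε0 n)
      simp only [hy]
      rw [sub_eq_add_neg 1 (ε n)]
      linarith
    · filter_upwards [hεlt] with n hn
      exact pow_le_one₀ (by linarith) (by linarith [hε0 n])
  have hTt : Tendsto (fun n : ℕ => (1 + 4 * v n / n) ^ (L n ^ 2)) atTop (𝓝 1) := by
    have hup : Tendsto (fun n : ℕ => Real.exp (4 * (v n ^ 2 / n))) atTop (𝓝 1) := by
      have := (t4.const_mul 4).rexp
      simpa using this
    refine tendsto_of_tendsto_of_tendsto_of_le_of_le tendsto_const_nhds hup ?_ ?_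
    · intro n
      exact one_le_pow₀ (by
        have := hv0 n
        have : 0 ≤ 4 * v n / n := by positivity
        linarith)
    · intro n
      have hx : 0 ≤ 4 * v n / n := by have := hv0 n; positivity
      calc (1 + 4 * v n / n) ^ (L n ^ 2) ≤ Real.exp (4 * v n / n) ^ (L n ^ 2) := by
            refine pow_le_pow_left₀ (by linarith) ?_ _
            linarith [Real.add_one_le_exp (4 * v n / n)]
        _ = Real.exp (4 * (v n ^ 2 / n)) := by
            rw [← Real.exp_nat_mul]
            congr 1
            simp only [hv]
            ring
  have hBt : Tendsto (fun n => y n - v n ^ 2 * (d n / n) / y n) atTop (𝓝 1) := by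
    have h1 : Tendsto (fun n => v n ^ 2 * (d n / n) / y n) atTop (𝓝 0) := by
      have := t5.div hyt one_ne_zero
      simp only [zero_div] at this
      refine this.congr fun n => ?_
      simp only [Pi.div_apply]
      ring
    simpa using hyt.sub h1
  have hFt : Tendsto (fun n => (1 - v n ^ 2 / n) * (y n - v n ^ 2 * (d n / n) / y n) ^ 2 *
      y n ^ 2 / (1 + 4 * v n / n) ^ (L n ^ 2)) atTop (𝓝 1) := by
    have := (((t4.const_sub 1).mul (hBt.pow 2)).mul (hyt.pow 2)).div hTt one_ne_zero
    simp only [sub_zero, one_pow, mul_one, div_one] at this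
    exact this
  refine tendsto_of_tendsto_of_tendsto_of_le_of_le' (hFt.mono_left inf_le_left)
    tendsto_const_nhds ?_ (Eventually.of_forall fun n => regularProb_le_one _ _ _)
  rw [eventually_inf_principal]
  filter_upwards [hεlt, hBt.eventually (lt_mem_nhds one_pos), eventually_gt_atTop 0,
    t1.eventually (gt_mem_nhds one_pos), t2.eventually (gt_mem_nhds (by norm_num : (0 : ℝ) < 1 / 5)),
    t4.eventually (gt_mem_nhds one_pos),
    t6.eventually (gt_mem_nhds (by norm_num : (0 : ℝ) < 1 / 16)),
    h1d.bound one_pos] with n hε1 hB hn hdn1 hd5 hvn1 hnd1 hd1 heven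
  have hn0 : (0 : ℝ) < n := by exact_mod_cast hn
  -- The bound 1/d < 1/5 alone would allow d = 0, since 1/0 = 0, so d ≥ 1 is obtained separately.
  have hd1' : (1 : ℝ) ≤ d n := by simpa using hd1
  have hd0 : (0 : ℝ) < d n := by linarith
  have hd5' : 5 ≤ d n := by
    rw [div_lt_div_iff₀ hd0 (by norm_num)] at hd5
    have : (5 : ℝ) < d n := by linarith
    exact_mod_cast this.le
  have hdn' : d n < n := by
    rw [div_lt_one hn0] at hdn1
    exact_mod_cast hdn1
  have hvn' : v n ≤ n := by
    rw [div_lt_one hn0] at hvn1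
    exact (hvle n).trans hvn1.le
  have hq : 16 * ((n : ℝ) / d n) ^ 2 ≤ n := by
    rw [div_lt_div_iff₀ (by positivity) (by norm_num)] at hnd1
    rw [div_pow, ← mul_div_assoc, div_le_iff₀ (by positivity)]
    nlinarith
  have hm : (9 / d n + d n / n : ℝ) + (2 * (d n * (d n + 1)) +
      2 * (2 * (gridArcs (L n)).card + 1 : ℕ) : ℝ) / (n * d n) ≤ ε n := by
    have h1 := hev n
    simp only [he] at h1
    have hn1' : (1 : ℝ) ≤ n := by exact_mod_cast hn
    have hdnR : (d n : ℝ) ≤ n := by exact_mod_cast hdn'.le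
    simp only [hεdef]
    push_cast
    have h2 : (2 * (d n * (d n + 1)) + 2 * (2 * ((gridArcs (L n)).card : ℝ) + 1)) / (n * d n) ≤
        2 * (d n / n) + 12 * (1 / d n) := by
      rw [div_le_iff₀ (by positivity)]
      have h3 : (2 * ((d n : ℝ) / n) + 12 * (1 / d n)) * (n * d n) = 2 * (d n * d n) + 12 * n := by
        field_simp
      rw [h3]
      linarith
    have h4 : (9 : ℝ) / d n = 9 * (1 / d n) := by ring
    rw [h4]
    linarith
  have hfin := le_regularProb (isTwoOrientation_gridArcs (L n)) hd5' hdn' heven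
    (by rw [hcardW]; exact Nat.cast_le.mp hvn') (hε0 n) hε1 hm hq rfl
    (by rw [hcardW]; exact hB.le)
  rw [hcardW] at hfin
  exact hfin
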